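/- For $M\in\mathbb R^{n\times d}$ of rank $d$ with rows $m_i^\top$, the leverage scores are $\sigma(M)_i=m_i^\top(M^\top M)^{-1}m_i$. Let $n\ge 1$, let $A\in\mathbb R^{n\times d}$ have full column rank, $\operatorname{rank}A=d$, let $1\le q\le 2$ and $c\in\mathbb R^n_{\ge0}$. The $c$-regularized $\ell_q$ Lewis weights of $A$ are the vector $w\in\mathbb R^n_{\ge0}$ that satisfies $$w_i=\sigma\big((C+W)^{\frac12-\frac1q}A\big)_i\quad\text{for all } i\in[n],\qquad C=\operatorname{diag}(c),\ W=\operatorname{diag}(w),$$ where $c_i+w_i>0$ is understood for each nonzero row $i$ of $A$ (so that the nonpositive power makes sense; a zero row stays zero). Such a $w$ exists and is unique. There is an integer $k$ such that for every constant $C_0>0$ there are a constant $K$ and a randomized algorithm $\textsc{ApproxRegLewis}(A,c,q)$ (one program for all $n,d,A,c,q$) with the following properties for all inputs as above. 1. With probability at least $1-n^{-C_0}$ it outputs a vector $\widehat w\in\mathbb R^n_{\ge 0}$ with $0.9\,w_i\le\widehat w_i\le 1.1\,w_i$ for all $i\in[n]$. 2. It always runs in $\widetilde O(\mathcal T_A)$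 time: its running time is at most $K(1+\log n)^k\,\mathcal T_A$. Here $\mathcal T_A$ is the time for solving (exactly) one linear system in $A^\top DA$ with $D$ a positive diagonal matrix, where $\mathcal T_A\ge\operatorname{nnz}(A)+n$, the size of the matrix and of $D$. The time counts $\mathcal T_A$ for each call to the solver and one unit for each other operation (arithmetic operations, comparisons and powers of real numbers, random signs); a product of $A$ or $A^\top$ with a vector takes $\operatorname{nnz}(A)+n+d$ operations. 3. The systems that it solves involve only $O(\log\log n)$ different reweightings $D$: it sets the matrix $D$ at most $K\,(1+\log(1+\log n))$ times. -/

import Mathlib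

open Matrix

namespace RegLewis

/-! ### Leverage scores and regularized Lewis weights -/

/-- The leverage score `σ(M)ᵢ = mᵢᵀ (Mᵀ M)⁻¹ mᵢ` of the `i`-th row `mᵢ` of `M`. -/
noncomputable def leverage {n d : ℕ} (M : Matrix (Fin n) (Fin d) ℝ) (i : Fin n) : ℝ :=
  M i ⬝ᵥ ((Mᵀ * M)⁻¹ *ᵥ M i)

/-- The reweighted matrix `(C + W)^(1/2 - 1/q) A`, with `C = diag c` and `W = diag w`. -/
noncomputable def reweighted {n d : ℕ} (A : Matrix (Fin n) (Fin d) ℝ) (q : ℝ)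
    (c w : Fin n → ℝ) : Matrix (Fin n) (Fin d) ℝ :=
  Matrix.diagonal (fun i => (c i + w i) ^ (1 / 2 - 1 / q)) * A

/-- `w` is a vector of `c`-regularized `ℓ_q` Lewis weights of `A`: it is nonnegative and
`wᵢ = σ((C + W)^(1/2 - 1/q) A)ᵢ` for all `i`.  Since `1/2 - 1/q ≤ 0`, the matrix on the right-hand
side only makes sense if `cᵢ + wᵢ > 0`, which is the field `pos`; it is not required at a zero
row of `A`, which is zero after any rescaling. -/
structure IsRegLewis {n d : ℕ} (A : Matrix (Fin n) (Fin d) ℝ) (q : ℝ)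
    (c w : Fin n → ℝ) : Prop where
  nonneg : ∀ i, 0 ≤ w i
  pos : ∀ i, A i ≠ 0 → 0 < c i + w i
  eq : ∀ i, w i = leverage (reweighted A q c w) i

/-- The number of nonzero entries of `A`. -/
noncomputable def nnz {n d : ℕ} (A : Matrix (Fin n) (Fin d) ℝ) : ℕ :=
  {p : Fin n × Fin d | A p.1 p.2 ≠ 0}.ncard

/-! ### A randomized real-arithmetic machine with a linear system solver

A program is a finite text that does not depend on the input.  It works on registers holding
vectors of `ℝⁿ` and of `ℝᵈ`.  A vector instruction is charged the number of scalar operations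
(exact real arithmetic, comparisons, real powers, random signs) that it stands for; products with
`A` and `Aᵀ` are charged for the nonzero entries of `A`.  Solves of linear systems in `Aᵀ D A`, for
a positive diagonal matrix `D`, are counted separately. -/

/-- Scalar expressions, evaluated coordinate by coordinate in vector assignments. -/
inductive Expr : Type
  /-- the current coordinate of the given register -/
  | reg : ℕ → Expr
  /-- a rational constant -/
  | const : ℚ → Expr
  /-- the exponent `q` of the input -/
  | expo : Expr
  | add : Expr → Expr → Expr
  | sub : Expr → Expr → Expr
  | mul : Expr → Expr → Expr
  | div : Expr → Expr → Expr
  /-- real powers of a positive base (value `0` if the base is not positive) -/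
  | pow : Expr → Expr → Expr
  /-- `ifLe a b s t` is `s` if `a ≤ b` and `t` otherwise -/
  | ifLe : Expr → Expr → Expr → Expr → Expr

open Classical in
/-- The value of an expression; `v k` is the value read from register `k`. -/
noncomputable def Expr.eval (q : ℝ) (v : ℕ → ℝ) : Expr → ℝ
  | .reg k => v k
  | .const r => (r : ℝ)
  | .expo => q
  | .add a b => a.eval q v + b.eval q v
  | .sub a b => a.eval q v - b.eval q v
  | .mul a b => a.eval q v * b.eval q v
  | .div a b => a.eval q v / b.eval q v
  | .pow a b => if 0 < a.eval q v then (a.eval q v) ^ (b.eval q v) else 0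
  | .ifLe a b s t => if a.eval q v ≤ b.eval q v then s.eval q v else t.eval q v

/-- The number of operations needed for one evaluation of an expression. -/
def Expr.size : Expr → ℕ
  | .reg _ => 1
  | .const _ => 1
  | .expo => 1
  | .add a b => a.size + b.size + 1
  | .sub a b => a.size + b.size + 1
  | .mul a b => a.size + b.size + 1
  | .div a b => a.size + b.size + 1
  | .pow a b => a.size + b.size + 1
  | .ifLe a b s t => a.size + b.size + s.size + t.size + 1

/-- Natural number expressions for the lengths of loops, in terms of the dimensions. -/
inductive Count : Type
  | const : ℕ → Count
  /-- the number `n` of rows of `A` -/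
  | rows : Count
  /-- the number `d` of columns of `A` -/
  | cols : Count
  | add : Count → Count → Count
  | mul : Count → Count → Count
  /-- the rounded-down binary logarithm -/
  | log : Count → Count

def Count.eval (n d : ℕ) : Count → ℕ
  | .const k => k
  | .rows => n
  | .cols => d
  | .add a b => a.eval n d + b.eval n d
  | .mul a b => a.eval n d * b.eval n d
  | .log a => Nat.log 2 (a.eval n d)

def Count.size : Count → ℕ
  | .const _ => 1
  | .rows => 1
  | .cols => 1
  | .add a b => a.size + b.size + 1
  | .mul a b => a.size + b.size + 1
  | .log a => a.size + 1

/-- Programs. Registers for `ℝⁿ` are called row registers, those for `ℝᵈ` column registers. -/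
inductive Prog : Type
  /-- one program after another -/
  | seq : Prog → Prog → Prog
  /-- repeat a program the given number of times -/
  | loop : Count → Prog → Prog
  /-- `assignRow k e`: coordinatewise assignment of `e` to the row register `k` -/
  | assignRow : ℕ → Expr → Prog
  /-- `assignCol k e`: coordinatewise assignment of `e` to the column register `k` -/
  | assignCol : ℕ → Expr → Prog
  /-- `signs k`: fill the row register `k` with independent uniformly random signs -/
  | signs : ℕ → Prog
  /-- `mulA k j`: row register `k` becomes `A` times column register `j` -/
  | mulA : ℕ → ℕ → Prog
  /-- `mulAT j k`: column register `j` becomes `Aᵀ` times row register `k` -/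
  | mulAT : ℕ → ℕ → Prog
  /-- `reweight k`: row register `k` becomes the diagonal of the matrix `D` of the solver -/
  | reweight : ℕ → Prog
  /-- `solve j l`: column register `j` becomes `(Aᵀ D A)⁻¹` times column register `l` -/
  | solve : ℕ → ℕ → Prog

/-- Configurations of the machine on an input matrix with `n` rows and `d` columns. -/
structure State (n d : ℕ) : Type where
  /-- the row registers -/
  row : ℕ → Fin n → ℝ
  /-- the column registers -/
  col : ℕ → Fin d → ℝ
  /-- the diagonal of the current matrix `D` -/
  diag : Fin n → ℝ
  /-- the number of times that `D` has been set -/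
  reweights : ℕ
  /-- the number of calls to the linear system solver so far -/
  solves : ℕ
  /-- the number of all other operations so far -/
  ops : ℕ

/-- Count `m` further operations. -/
def State.charge {n d : ℕ} (s : State n d) (m : ℕ) : State n d :=
  { s with ops := s.ops + m }

/-- The running time, if one call to the solver takes time `T`. -/
noncomputable def State.time {n d : ℕ} (s : State n d) (T : ℝ) : ℝ :=
  T * s.solves + s.ops

open Classical in
/-- The answer of the solver: the exact solution `x` of `Aᵀ D A x = b` if the diagonal matrix `D`
is positive. (The solver gives no information otherwise.) -/
noncomputable def solution {n d : ℕ} (A : Matrix (Fin n) (Fin d) ℝ) (D : Fin n → ℝ)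
    (b : Fin d → ℝ) : Fin d → ℝ :=
  if ∀ i, 0 < D i then (Aᵀ * Matrix.diagonal D * A)⁻¹ *ᵥ b else 0

/-- `m`-fold repetition of a randomized step. -/
noncomputable def repeatStep {α : Type} (f : α → PMF α) : ℕ → α → PMF α
  | 0, s => PMF.pure s
  | m + 1, s => (f s).bind (repeatStep f m)

/-- The distribution of the configuration after running a program on `A`, `q` from a given
configuration. -/
noncomputable def Prog.run {n d : ℕ} (A : Matrix (Fin n) (Fin d) ℝ) (q : ℝ) :
    Prog → State n d → PMF (State n d)
  | .seq P Q, s => (P.run A q s).bind (Q.run A q)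
  | .loop m P, s =>
      repeatStep (fun s' => P.run A q (s'.charge 1)) (m.eval n d) (s.charge m.size)
  | .assignRow k e, s =>
      PMF.pure
        { s with
          row := Function.update s.row k (fun i => e.eval q (fun l => s.row l i))
          ops := s.ops + n * e.size }
  | .assignCol k e, s =>
      PMF.pure
        { s with
          col := Function.update s.col k (fun i => e.eval q (fun l => s.col l i))
          ops := s.ops + d * e.size }
  | .signs k, s =>
      (PMF.uniformOfFintype (Fin n → Bool)).map fun b =>
        { s with
          row := Function.update s.row k (fun i => if b i then 1 else -1)
          ops := s.ops + n }
  | .mulA k j, s =>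
      PMF.pure
        { s with
          row := Function.update s.row k (A *ᵥ s.col j)
          ops := s.ops + (nnz A + n + d) }
  | .mulAT j k, s =>
      PMF.pure
        { s with
          col := Function.update s.col j (Aᵀ *ᵥ s.row k)
          ops := s.ops + (nnz A + n + d) }
  | .reweight k, s =>
      PMF.pure
        { s with
          diag := s.row k
          reweights := s.reweights + 1
          ops := s.ops + n }
  | .solve j l, s =>
      PMF.pure
        { s with
          col := Function.update s.col j (solution A s.diag (s.col l))
          solves := s.solves + 1 }

/-- The initial configuration: the row register `0` holds `c`. -/
def State.init {n d : ℕ} (c : Fin n → ℝ) : State n d where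
  row := fun k => if k = 0 then c else 0
  col := fun _ => 0
  diag := fun _ => 1
  reweights := 0
  solves := 0
  ops := 0

/-- The distribution of the final configuration of the program `P` on the input `(A, c, q)`. -/
noncomputable def Prog.final {n d : ℕ} (P : Prog) (A : Matrix (Fin n) (Fin d) ℝ)
    (c : Fin n → ℝ) (q : ℝ) : PMF (State n d) :=
  P.run A q (State.init c)

/-- The output of a program: the content of the row register `0` at the end. -/
def State.output {n d : ℕ} (s : State n d) : Fin n → ℝ := s.row 0

end RegLewis

/-! Put θ = 2/q - 1, which lies in [0, 1], and u = c + w. At a nonzero row the defining equation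
reads w_i (c_i + w_i)^θ = a_iᵀ (Aᵀ diag(u^(-θ)) A)⁻¹ a_i. So u is a fixed point, on the nonzero
rows, of the map that computes the quadratic forms for u and then solves one scalar equation per
row. If u changes by factors of at most e^a, the forms change by at most e^(aθ), and the shifted
roots c + w by at most e^(aθ/(1+θ)) ≤ e^(a/2) (`iteration_contracts`). Halving of logarithmic
distances gives uniqueness; it also yields an invariant box, on which the map is monotone, and
Knaster–Tarski gives existence.

The algorithm runs this iteration from u = c + 1, where the quadratic forms are already correct up
to a factor 4n (`approximates_start`). The initial error log(4n) is halved in each round, so O(log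
log n) rounds suffice, and each round sets `D` once. The errors made inside the rounds stay bounded
because the contraction sums them geometrically (`approximates_step`).

Within a round the forms are estimated by averaging the squared coordinates of A (Aᵀ D A)⁻¹ Aᵀ
D^(1/2) s over random sign vectors s. The exponential moments of a squared sign sum are dominated by
those of a Gaussian (`bitMean_exp_sq_le`), so O(log n) samples with the same `D` give every row
within one percent with high probability (`triple_samples`). The scalar equation is solved
numerically: an explicit value is correct up to a factor 2 (`initial_root_approx`), and a damped
iteration halves its logarithmic error (`scalar_step_halves`).

Hoare triples that carry failure probabilities transfer the analysis to the program. Its control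
flow never depends on data, so its cost is the same in every run. -/

namespace RegLewis

/-! ### Quadratic forms of the Gram matrix -/

section Gram

variable {n d : ℕ} {A : Matrix (Fin n) (Fin d) ℝ} {D D' : Fin n → ℝ}

/-- The Gram matrix `Aᵀ D A`. -/
noncomputable def gram (A : Matrix (Fin n) (Fin d) ℝ) (D : Fin n → ℝ) :
    Matrix (Fin d) (Fin d) ℝ :=
  Aᵀ * Matrix.diagonal D * A

/-- The quadratic form `xᵀ Aᵀ D A x`. -/
noncomputable def energy (A : Matrix (Fin n) (Fin d) ℝ) (D : Fin n → ℝ) (x : Fin d → ℝ) : ℝ :=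
  ∑ j, D j * (A j ⬝ᵥ x) ^ 2

/-- The number `aᵢᵀ (Aᵀ D A)⁻¹ aᵢ`. -/
noncomputable def quad (A : Matrix (Fin n) (Fin d) ℝ) (D : Fin n → ℝ) (i : Fin n) : ℝ :=
  A i ⬝ᵥ ((gram A D)⁻¹ *ᵥ A i)

theorem dotProduct_gram_mulVec (D : Fin n → ℝ) (x y : Fin d → ℝ) :
    x ⬝ᵥ (gram A D *ᵥ y) = ∑ j, D j * ((A j ⬝ᵥ x) * (A j ⬝ᵥ y)) := by
  have h : gram A D *ᵥ y = Aᵀ *ᵥ (fun j => D j * (A j ⬝ᵥ y)) := by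
    rw [gram, ← Matrix.mulVec_mulVec, ← Matrix.mulVec_mulVec]
    congr 1
    ext j
    rw [Matrix.mulVec_diagonal]
    rfl
  rw [h, Matrix.dotProduct_mulVec, Matrix.vecMul_transpose, dotProduct]
  refine Finset.sum_congr rfl fun j _ => ?_
  change (A j ⬝ᵥ x) * _ = _
  ring

theorem dotProduct_gram_mulVec_self (D : Fin n → ℝ) (x : Fin d → ℝ) :
    x ⬝ᵥ (gram A D *ᵥ x) = energy A D x := by
  rw [dotProduct_gram_mulVec, energy]
  exact Finset.sum_congr rfl fun j _ => by ring

theorem gram_isSymm (D : Fin n → ℝ) : (gram A D)ᵀ = gram A D := by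
  simp [gram, Matrix.transpose_mul, Matrix.mul_assoc]

theorem energy_nonneg (hD : ∀ i, 0 < D i) (x : Fin d → ℝ) : 0 ≤ energy A D x :=
  Finset.sum_nonneg fun j _ => mul_nonneg (hD j).le (sq_nonneg _)

theorem energy_le_mul {γ : ℝ} (h : ∀ i, A i ≠ 0 → D i ≤ γ * D' i) (x : Fin d → ℝ) :
    energy A D x ≤ γ * energy A D' x := by
  rw [energy, energy, Finset.mul_sum]
  refine Finset.sum_le_sum fun j _ => ?_
  by_cases hj : A j = 0
  · simp [hj]
  · rw [← mul_assoc]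
    exact mul_le_mul_of_nonneg_right (h j hj) (sq_nonneg _)

theorem mulVec_injective_of_rank (hA : A.rank = d) : Function.Injective A.mulVec := by
  have h1 : Module.finrank ℝ (LinearMap.range A.mulVecLin) = d := hA
  have h2 := LinearMap.finrank_range_add_finrank_ker A.mulVecLin
  rw [h1, Module.finrank_fin_fun] at h2
  have h3 : Module.finrank ℝ (LinearMap.ker A.mulVecLin) = 0 := by omega
  rw [Submodule.finrank_eq_zero] at h3
  exact LinearMap.ker_eq_bot.mp h3

theorem gram_posDef (hA : A.rank = d) (hD : ∀ i, 0 < D i) : (gram A D).PosDef := by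
  have h := (Matrix.PosDef.diagonal hD).conjTranspose_mul_mul_same (mulVec_injective_of_rank hA)
  rwa [Matrix.conjTranspose_eq_transpose_of_trivial] at h

theorem gram_mulVec_inv (hA : A.rank = d) (hD : ∀ i, 0 < D i) (b : Fin d → ℝ) :
    gram A D *ᵥ ((gram A D)⁻¹ *ᵥ b) = b := by
  have h := (Matrix.isUnit_iff_isUnit_det _).mp (gram_posDef hA hD).isUnit
  rw [Matrix.mulVec_mulVec, Matrix.mul_nonsing_inv _ h, Matrix.one_mulVec]

theorem dotProduct_inv_eq_energy (hA : A.rank = d) (hD : ∀ i, 0 < D i) (b : Fin d → ℝ) :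
    b ⬝ᵥ ((gram A D)⁻¹ *ᵥ b) = energy A D ((gram A D)⁻¹ *ᵥ b) := by
  rw [← dotProduct_gram_mulVec_self, gram_mulVec_inv hA hD, dotProduct_comm]

theorem quad_eq_energy (hA : A.rank = d) (hD : ∀ i, 0 < D i) (i : Fin n) :
    quad A D i = energy A D ((gram A D)⁻¹ *ᵥ A i) :=
  dotProduct_inv_eq_energy hA hD _

theorem quad_nonneg (hA : A.rank = d) (hD : ∀ i, 0 < D i) (i : Fin n) : 0 ≤ quad A D i := by
  rw [quad_eq_energy hA hD]
  exact energy_nonneg hD _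

theorem quad_pos (hA : A.rank = d) (hD : ∀ i, 0 < D i) {i : Fin n} (hi : A i ≠ 0) :
    0 < quad A D i := by
  have h := (gram_posDef hA hD).inv.dotProduct_mulVec_pos hi
  simpa [quad] using h

theorem quad_eq_zero {i : Fin n} (hi : A i = 0) : quad A D i = 0 := by
  simp [quad, hi]

/-- The Cauchy–Schwarz inequality for the dual norms of the Gram matrix. -/
theorem sq_dotProduct_le (hA : A.rank = d) (hD : ∀ i, 0 < D i) (i : Fin n) (x : Fin d → ℝ) :
    (A i ⬝ᵥ x) ^ 2 ≤ energy A D x * quad A D i := by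
  set y := (gram A D)⁻¹ *ᵥ A i with hy
  have h1 : A i ⬝ᵥ x = ∑ j, D j * ((A j ⬝ᵥ x) * (A j ⬝ᵥ y)) := by
    rw [← dotProduct_gram_mulVec, hy, gram_mulVec_inv hA hD, dotProduct_comm]
  rw [quad_eq_energy hA hD, ← hy, h1, energy, energy]
  have h2 := Finset.sum_mul_sq_le_sq_mul_sq Finset.univ
    (fun j => √(D j) * (A j ⬝ᵥ x)) (fun j => √(D j) * (A j ⬝ᵥ y))
  have e : ∀ j, √(D j) * √(D j) = D j := fun j => Real.mul_self_sqrt (hD j).le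
  refine le_of_eq_of_le ?_ (h2.trans_eq ?_)
  · congr 1
    refine Finset.sum_congr rfl fun j _ => ?_
    linear_combination (-(A j ⬝ᵥ x) * (A j ⬝ᵥ y)) * e j
  · congr 1 <;> refine Finset.sum_congr rfl fun j _ => ?_ <;>
      rw [mul_pow, Real.sq_sqrt (hD j).le]

/-- Inversion reverses the order of quadratic forms. Cauchy–Schwarz for `D` at y = (Aᵀ D' A)⁻¹ aᵢ
gives (quad D')² ≤ energy D y · quad D, and the energy of y for `D'` is quad D', so one factor
cancels. -/
theorem quad_le_mul_of_energy_le (hA : A.rank = d) (hD : ∀ i, 0 < D i) (hD' : ∀ i, 0 < D' i)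
    {γ : ℝ} (h : ∀ x, energy A D x ≤ γ * energy A D' x) (i : Fin n) :
    quad A D' i ≤ γ * quad A D i := by
  rcases (quad_nonneg hA hD' i).eq_or_lt with h0 | h0
  · by_cases hi : A i = 0
    · simp [quad_eq_zero hi]
    · exact absurd h0 (quad_pos hA hD' hi).ne
  · set y := (gram A D')⁻¹ *ᵥ A i with hy
    have h1 := sq_dotProduct_le hA hD i y
    have h2 : A i ⬝ᵥ y = quad A D' i := rfl
    have h3 : energy A D y ≤ γ * quad A D' i := by
      rw [quad_eq_energy hA hD']
      exact h y
    rw [h2] at h1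
    have h4 := h1.trans (mul_le_mul_of_nonneg_right h3 (quad_nonneg hA hD i))
    have h5 : quad A D' i * quad A D' i ≤ quad A D' i * (γ * quad A D i) := by nlinarith
    exact le_of_mul_le_mul_left h5 h0

theorem quad_le_mul (hA : A.rank = d) (hD : ∀ i, 0 < D i) (hD' : ∀ i, 0 < D' i)
    {γ : ℝ} (h : ∀ i, A i ≠ 0 → D i ≤ γ * D' i) (i : Fin n) :
    quad A D' i ≤ γ * quad A D i :=
  quad_le_mul_of_energy_le hA hD hD' (energy_le_mul h) i

/-- A leverage score is at most 1: the form is itself an energy, and the single summand j = i is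
already `D i * quad A D i ^ 2`. -/
theorem mul_quad_le_one (hA : A.rank = d) (hD : ∀ i, 0 < D i) (i : Fin n) :
    D i * quad A D i ≤ 1 := by
  by_cases hi : A i = 0
  · simp [quad_eq_zero hi]
  have h0 := quad_pos hA hD hi
  have h1 : D i * quad A D i ^ 2 ≤ quad A D i := by
    conv_rhs => rw [quad_eq_energy hA hD, energy]
    exact Finset.single_le_sum (f := fun j => D j * (A j ⬝ᵥ ((gram A D)⁻¹ *ᵥ A i)) ^ 2)
      (fun j _ => mul_nonneg (hD j).le (sq_nonneg _)) (Finset.mem_univ i)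
  have h2 : (D i * quad A D i) * quad A D i ≤ 1 * quad A D i := by nlinarith
  exact le_of_mul_le_mul_right h2 h0

end Gram

/-! ### The scalar equation `w (c + w) ^ θ = p` -/

section Scalar

theorem rpow_le_exp_mul {x y a s : ℝ} (hx : 0 < x) (hy : 0 < y) (hs : 0 ≤ s)
    (h : y ≤ Real.exp a * x) : y ^ s ≤ Real.exp (a * s) * x ^ s := by
  calc y ^ s ≤ (Real.exp a * x) ^ s := Real.rpow_le_rpow hy.le h hs
    _ = _ := by rw [Real.mul_rpow (Real.exp_pos a).le hx.le, Real.exp_mul]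

theorem exists_scalar_root {c θ p : ℝ} (hc : 0 ≤ c) (hθ : 0 ≤ θ) (hp : 0 ≤ p) :
    ∃ w : ℝ, 0 ≤ w ∧ w * (c + w) ^ θ = p := by
  have hcont : Continuous fun w : ℝ => w * (c + w) ^ θ :=
    continuous_id.mul ((continuous_const.add continuous_id).rpow_const fun _ => Or.inr hθ)
  have h1 : p ≤ (p + 1) * (c + (p + 1)) ^ θ := by
    have := Real.one_le_rpow (show 1 ≤ c + (p + 1) by linarith) hθ
    nlinarith
  obtain ⟨w, hw, hwp⟩ := intermediate_value_Icc (show (0 : ℝ) ≤ p + 1 by linarith)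
    hcont.continuousOn (show p ∈ Set.Icc _ _ from ⟨by simpa using hp, h1⟩)
  exact ⟨w, hw.1, hwp⟩

theorem scalar_root_lt {c θ w w' : ℝ} (hc : 0 ≤ c) (hθ : 0 ≤ θ) (hw : 0 < w) (h : w < w') :
    w * (c + w) ^ θ < w' * (c + w') ^ θ := by
  have h1 : (c + w) ^ θ ≤ (c + w') ^ θ := Real.rpow_le_rpow (by linarith) (by linarith) hθ
  have h2 : 0 < (c + w) ^ θ := Real.rpow_pos_of_pos (by linarith) _
  nlinarith

theorem scalar_root_pos {c θ w p : ℝ} (hw : 0 ≤ w) (h : w * (c + w) ^ θ = p)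
    (hp : 0 < p) : 0 < w := by
  rcases hw.eq_or_lt with rfl | h1
  · simp at h; linarith
  · exact h1

theorem scalar_root_le_exp {c θ b w w' : ℝ} (hc : 0 ≤ c) (hθ : 0 ≤ θ) (hb : 0 ≤ b)
    (hw : 0 < w) (h : w' * (c + w') ^ θ ≤ Real.exp b * (w * (c + w) ^ θ)) :
    w' ≤ Real.exp b * w := by
  by_contra! hlt
  have h1 : (1 : ℝ) ≤ Real.exp b := Real.one_le_exp hb
  have h2 : w ≤ Real.exp b * w := by nlinarith
  have h3 := scalar_root_lt hc hθ (by linarith) hlt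
  have h4 : (c + w) ^ θ ≤ (c + Real.exp b * w) ^ θ :=
    Real.rpow_le_rpow (by linarith) (by linarith) hθ
  have h5 : Real.exp b * (w * (c + w) ^ θ) ≤ Real.exp b * w * (c + Real.exp b * w) ^ θ := by
    rw [← mul_assoc]; exact mul_le_mul_of_nonneg_left h4 (by linarith)
  linarith

/-- Source of the contraction. With γ = e^(b/(1+θ)), scaling c + w by γ scales w by at least γ,
since c ≥ 0, so the left side of the equation grows by at least γ^(1+θ) = e^b. -/
theorem scalar_shifted_root_le_exp {c θ b w w' : ℝ} (hc : 0 ≤ c) (hθ : 0 ≤ θ) (hb : 0 ≤ b)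
    (hw : 0 < w) (h : w' * (c + w') ^ θ ≤ Real.exp b * (w * (c + w) ^ θ)) :
    c + w' ≤ Real.exp (b / (1 + θ)) * (c + w) := by
  by_contra! hlt
  have h0 : 0 ≤ b / (1 + θ) := by positivity
  have h1 : (1 : ℝ) ≤ Real.exp (b / (1 + θ)) := Real.one_le_exp h0
  set γ := Real.exp (b / (1 + θ)) with hγ
  have hγp : 0 < γ := by linarith
  have hw' : γ * (c + w) - c < w' := by linarith
  have h2 : γ * w ≤ γ * (c + w) - c := by nlinarith
  have h3 := scalar_root_lt hc hθ (lt_of_lt_of_le (by positivity) h2) hw'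
  have h4 : γ * γ ^ θ = Real.exp b := by
    rw [hγ, ← Real.exp_mul, ← Real.exp_add]
    congr 1
    field_simp
  rw [show c + (γ * (c + w) - c) = γ * (c + w) by ring,
    Real.mul_rpow hγp.le (by linarith : 0 ≤ c + w)] at h3
  have h5 : Real.exp b * (w * (c + w) ^ θ) = γ * w * (γ ^ θ * (c + w) ^ θ) := by
    rw [← h4]; ring
  have h6 : 0 ≤ γ ^ θ * (c + w) ^ θ :=
    mul_nonneg (Real.rpow_nonneg hγp.le _) (Real.rpow_nonneg (by linarith) _)
  have h7 := mul_le_mul_of_nonneg_right h2 h6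
  linarith

end Scalar

/-! ### The Lewis weight iteration -/

section Iteration

variable {n d : ℕ} {A : Matrix (Fin n) (Fin d) ℝ} {q : ℝ} {c : Fin n → ℝ}

/-- The positive diagonal `u ^ (1 - 2 / q)`, with value `1` where `u` is not positive. -/
noncomputable def weightDiag {n : ℕ} (q : ℝ) (u : Fin n → ℝ) (i : Fin n) : ℝ :=
  if u i ≤ 0 then 1 else u i ^ (1 - 2 / q)

theorem weightDiag_pos (q : ℝ) (u : Fin n → ℝ) (i : Fin n) : 0 < weightDiag q u i := by
  unfold weightDiag
  split_ifs with h
  · exact one_pos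
  · exact Real.rpow_pos_of_pos (not_le.mp h) _

theorem weightDiag_of_pos {u : Fin n → ℝ} {i : Fin n} (h : 0 < u i) :
    weightDiag q u i = u i ^ (1 - 2 / q) :=
  if_neg (not_le.mpr h)

theorem exponent_nonneg (hq : 1 ≤ q) (hq' : q ≤ 2) : 0 ≤ 2 / q - 1 := by
  have : 1 ≤ 2 / q := by rw [le_div_iff₀ (by linarith)]; linarith
  linarith

theorem exponent_le_one (hq : 1 ≤ q) : 2 / q - 1 ≤ 1 := by
  have : 2 / q ≤ 2 := by rw [div_le_iff₀ (by linarith)]; linarith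
  linarith

/-- Zero rows do not enter the Gram matrix, so the default value 1 in `weightDiag`, which keeps the
diagonal positive there, is harmless. -/
theorem gram_congr {D D' : Fin n → ℝ} (h : ∀ i, A i ≠ 0 → D i = D' i) :
    gram A D = gram A D' := by
  ext a b
  rw [gram, gram, Matrix.mul_apply, Matrix.mul_apply]
  refine Finset.sum_congr rfl fun j _ => ?_
  by_cases hj : A j = 0
  · rw [show A j b = 0 from congrFun hj b, mul_zero, mul_zero]
  · rw [Matrix.mul_diagonal, Matrix.mul_diagonal, h j hj]

theorem weightDiag_le_exp_mul (hq : 1 ≤ q) (hq' : q ≤ 2) {u u' : Fin n → ℝ} {a : ℝ} {i : Fin n}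
    (hu : 0 < u i) (hu' : 0 < u' i) (h : u' i ≤ Real.exp a * u i) :
    weightDiag q u i ≤ Real.exp (a * (2 / q - 1)) * weightDiag q u' i := by
  rw [weightDiag_of_pos hu, weightDiag_of_pos hu', show 1 - 2 / q = -(2 / q - 1) by ring,
    Real.rpow_neg hu.le, Real.rpow_neg hu'.le]
  have h1 := rpow_le_exp_mul hu hu' (exponent_nonneg hq hq') h
  have h2 := Real.rpow_pos_of_pos hu (2 / q - 1)
  have h3 := Real.rpow_pos_of_pos hu' (2 / q - 1)
  rw [← div_eq_mul_inv, le_div_iff₀ h3, inv_mul_le_iff₀ h2]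
  linarith

theorem quad_weightDiag_le (hA : A.rank = d) (hq : 1 ≤ q) (hq' : q ≤ 2) {u u' : Fin n → ℝ} {a : ℝ}
    (hu : ∀ i, A i ≠ 0 → 0 < u i) (hu' : ∀ i, A i ≠ 0 → 0 < u' i)
    (h : ∀ i, A i ≠ 0 → u' i ≤ Real.exp a * u i) (i : Fin n) :
    quad A (weightDiag q u') i ≤ Real.exp (a * (2 / q - 1)) * quad A (weightDiag q u) i :=
  quad_le_mul hA (weightDiag_pos q u) (weightDiag_pos q u')
    (fun j hj => weightDiag_le_exp_mul hq hq' (hu j hj) (hu' j hj) (h j hj)) i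

theorem half_contraction {a θ : ℝ} (ha : 0 ≤ a) (hθ : 0 ≤ θ) (hθ' : θ ≤ 1) :
    a * θ / (1 + θ) ≤ a / 2 := by
  rw [div_le_iff₀ (by linarith)]
  nlinarith

/-- The map `u ↦ c + w`, where `w (c + w) ^ (2 / q - 1) = quad`, halves logarithmic distances. -/
theorem iteration_contracts (hA : A.rank = d) (hq : 1 ≤ q) (hq' : q ≤ 2)
    {u u' w w' : Fin n → ℝ} {a : ℝ} (ha : 0 ≤ a)
    (hu : ∀ i, A i ≠ 0 → 0 < u i) (hu' : ∀ i, A i ≠ 0 → 0 < u' i)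
    (h : ∀ i, A i ≠ 0 → u' i ≤ Real.exp a * u i) {i : Fin n} (hi : A i ≠ 0)
    (hc : 0 ≤ c i) (hw : 0 ≤ w i)
    (e : w i * (c i + w i) ^ (2 / q - 1) = quad A (weightDiag q u) i)
    (e' : w' i * (c i + w' i) ^ (2 / q - 1) = quad A (weightDiag q u') i) :
    c i + w' i ≤ Real.exp (a / 2) * (c i + w i) := by
  have hθ := exponent_nonneg hq hq'
  have hw0 := scalar_root_pos hw e (quad_pos hA (weightDiag_pos q u) hi)
  have h1 := quad_weightDiag_le hA hq hq' hu hu' h i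
  rw [← e, ← e'] at h1
  have h2 := scalar_shifted_root_le_exp hc hθ (mul_nonneg ha hθ) hw0 h1
  refine h2.trans (mul_le_mul_of_nonneg_right ?_ (by linarith))
  exact Real.exp_le_exp.mpr (half_contraction ha hθ (exponent_le_one hq))

theorem leverage_reweighted {w : Fin n → ℝ} (hpos : ∀ i, A i ≠ 0 → 0 < c i + w i)
    {i : Fin n} (hi : A i ≠ 0) :
    leverage (reweighted A q c w) i =
      (c i + w i) ^ (1 - 2 / q) * quad A (weightDiag q (c + w)) i := by
  have hrow : reweighted A q c w i = (c i + w i) ^ (1 / 2 - 1 / q) • A i := by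
    ext a
    simp [reweighted, Matrix.diagonal_mul]
  have hsq : ∀ j, A j ≠ 0 → (c j + w j) ^ (1 / 2 - 1 / q) * (c j + w j) ^ (1 / 2 - 1 / q) =
      (c j + w j) ^ (1 - 2 / q) := fun j hj => by
    rw [← Real.rpow_add (hpos j hj)]
    congr 1
    ring
  have hgram : (reweighted A q c w)ᵀ * reweighted A q c w = gram A (weightDiag q (c + w)) := by
    rw [gram_congr (D' := fun j => (c j + w j) ^ (1 / 2 - 1 / q) * (c j + w j) ^ (1 / 2 - 1 / q))]
    · simp only [reweighted, gram, Matrix.transpose_mul, Matrix.diagonal_transpose]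
      rw [← Matrix.diagonal_mul_diagonal]
      simp only [Matrix.mul_assoc]
    · intro j hj
      rw [weightDiag_of_pos (show 0 < (c + w) j from hpos j hj), hsq j hj]
      rfl
  rw [leverage, hgram, hrow, Matrix.mulVec_smul, dotProduct_smul, smul_dotProduct, smul_eq_mul,
    smul_eq_mul, ← mul_assoc, hsq i hi, quad]

theorem leverage_reweighted_of_zero {w : Fin n → ℝ} {i : Fin n} (hi : A i = 0) :
    leverage (reweighted A q c w) i = 0 := by
  have hrow : reweighted A q c w i = 0 := by
    ext a
    simp [reweighted, Matrix.diagonal_mul, hi]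
  simp [leverage, hrow]

theorem eq_rpow_mul_iff {u w p s : ℝ} (hu : 0 < u) : w = u ^ (1 - s) * p ↔ w * u ^ (s - 1) = p := by
  have h := Real.rpow_pos_of_pos hu (s - 1)
  rw [show 1 - s = -(s - 1) by ring, Real.rpow_neg hu.le, eq_inv_mul_iff_mul_eq₀ h.ne', mul_comm]

/-- The leverage score is u^(1 - 2/q) times the quadratic form; moving the power to the other side
exposes Lewis weights as a fixed point of the quadratic form and scalar root maps. -/
theorem isRegLewis_iff {w : Fin n → ℝ} :
    IsRegLewis A q c w ↔ (∀ i, 0 ≤ w i) ∧ (∀ i, A i = 0 → w i = 0) ∧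
      ∀ i, A i ≠ 0 → 0 < c i + w i ∧
        w i * (c i + w i) ^ (2 / q - 1) = quad A (weightDiag q (c + w)) i := by
  constructor
  · intro h
    refine ⟨h.nonneg, fun i hi => ?_, fun i hi => ⟨h.pos i hi, ?_⟩⟩
    · rw [h.eq i, leverage_reweighted_of_zero hi]
    · rw [← eq_rpow_mul_iff (h.pos i hi), ← leverage_reweighted h.pos hi]
      exact h.eq i
  · rintro ⟨h1, h2, h3⟩
    refine ⟨h1, fun i hi => (h3 i hi).1, fun i => ?_⟩
    by_cases hi : A i = 0
    · rw [leverage_reweighted_of_zero hi, h2 i hi]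
    · rw [leverage_reweighted (fun i hi => (h3 i hi).1) hi, eq_rpow_mul_iff (h3 i hi).1]
      exact (h3 i hi).2

/-- At the row with the largest ratio e^a of c + w' to c + w, the contraction gives a ≤ a/2 if a >
0, so a ≤ 0 and no row can increase. Uniqueness applies this both ways. -/
theorem regLewis_le (hA : A.rank = d) (hq : 1 ≤ q) (hq' : q ≤ 2) (hc : ∀ i, 0 ≤ c i)
    {w w' : Fin n → ℝ} (h : IsRegLewis A q c w) (h' : IsRegLewis A q c w') (i : Fin n) :
    w' i ≤ w i := by
  obtain ⟨h1, h2, h3⟩ := isRegLewis_iff.mp h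
  obtain ⟨h1', h2', h3'⟩ := isRegLewis_iff.mp h'
  by_cases hi : A i = 0
  · rw [h2 i hi, h2' i hi]
  classical
  obtain ⟨j, hj, hmax⟩ := Finset.exists_max_image (Finset.univ.filter fun j => A j ≠ 0)
    (fun j => Real.log ((c j + w' j) / (c j + w j))) ⟨i, by simpa using hi⟩
  set a := Real.log ((c j + w' j) / (c j + w j)) with ha
  have hle : ∀ k, A k ≠ 0 → (c + w') k ≤ Real.exp a * (c + w) k := by
    intro k hk
    have e := Real.exp_le_exp.mpr (hmax k (by simpa using hk))
    rw [Real.exp_log (div_pos (h3' k hk).1 (h3 k hk).1), div_le_iff₀ (h3 k hk).1] at e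
    exact e
  have ha0 : a ≤ 0 := by
    by_contra! hpos
    have hj : A j ≠ 0 := by simpa using hj
    have h4 := iteration_contracts hA hq hq' hpos.le (fun i hi => (h3 i hi).1)
      (fun i hi => (h3' i hi).1) hle hj (hc j) (h1 j) (h3 j hj).2 (h3' j hj).2
    rw [← div_le_iff₀ (h3 j hj).1, ← Real.log_le_iff_le_exp
      (div_pos (h3' j hj).1 (h3 j hj).1)] at h4
    linarith
  have h5 : (c + w') i ≤ 1 * (c + w) i := (hle i hi).trans
    (mul_le_mul_of_nonneg_right (Real.exp_le_one_iff.mpr ha0) (h3 i hi).1.le)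
  simp only [Pi.add_apply, one_mul] at h5
  linarith

theorem exists_isRegLewis (hA : A.rank = d) (hq : 1 ≤ q) (hq' : q ≤ 2) (hc : ∀ i, 0 ≤ c i) :
    ∃ w, IsRegLewis A q c w := by
  have hθ := exponent_nonneg hq hq'
  have hroot : ∀ (u : Fin n → ℝ) (i : Fin n), ∃ w : ℝ, 0 ≤ w ∧
      w * (c i + w) ^ (2 / q - 1) = quad A (weightDiag q u) i := fun u i =>
    exists_scalar_root (hc i) hθ (quad_nonneg hA (weightDiag_pos q u) i)
  choose r hr0 hr using hroot
  have hrpos : ∀ u i, A i ≠ 0 → 0 < r u i := fun u i hi =>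
    scalar_root_pos (hr0 u i) (hr u i) (quad_pos hA (weightDiag_pos q u) hi)
  classical
  -- The value 1 at zero rows keeps all coordinates positive, so logarithmic distances make sense
  -- everywhere.
  let F : (Fin n → ℝ) → Fin n → ℝ := fun u i => if A i = 0 then 1 else c i + r u i
  have hFpos : ∀ u i, 0 < F u i := fun u i => by
    simp only [F]
    split_ifs with h
    · exact one_pos
    · linarith [hrpos u i h, hc i]
  have hF : ∀ (u u' : Fin n → ℝ) (a : ℝ), 0 ≤ a → (∀ i, 0 < u i) → (∀ i, 0 < u' i) →
      (∀ i, u' i ≤ Real.exp a * u i) → ∀ i, F u' i ≤ Real.exp (a / 2) * F u i := by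
    intro u u' a ha hu hu' h i
    simp only [F]
    split_ifs with hi
    · rw [mul_one]; exact Real.one_le_exp (by linarith)
    · exact iteration_contracts hA hq hq' ha (fun i _ => hu i) (fun i _ => hu' i)
        (fun i _ => h i) hi (hc i) (hr0 u i) (hr u i) (hr u' i)
  obtain ⟨a, ha0, ha⟩ : ∃ a : ℝ, 0 ≤ a ∧ ∀ i, F 1 i ≤ Real.exp a ∧ 1 ≤ Real.exp a * F 1 i := by
    refine ⟨∑ i, |Real.log (F 1 i)|, Finset.sum_nonneg fun i _ => abs_nonneg _, fun i => ?_⟩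
    have h1 : |Real.log (F 1 i)| ≤ ∑ i, |Real.log (F 1 i)| :=
      Finset.single_le_sum (f := fun i => |Real.log (F 1 i)|) (fun i _ => abs_nonneg _)
        (Finset.mem_univ i)
    have h2 := abs_le.mp h1
    constructor
    · rw [← Real.log_le_iff_le_exp (hFpos 1 i)]
      exact h2.2
    · have h3 := Real.one_le_exp (show 0 ≤ ∑ i, |Real.log (F 1 i)| + Real.log (F 1 i) by
        linarith [h2.1])
      rwa [Real.exp_add, Real.exp_log (hFpos 1 i)] at h3
  -- If `F 1` is within e^a of 1, the box of logarithmic radius 2a is invariant: its endpoints are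
  -- sent within 2a/2 of `F 1`, hence within 2a of 1.
  let lo : Fin n → ℝ := fun _ => Real.exp (-(2 * a))
  let hi : Fin n → ℝ := fun _ => Real.exp (2 * a)
  have hlohi : lo ≤ hi := fun i => Real.exp_le_exp.mpr (by linarith)
  have hlo : lo ≤ F lo := by
    intro i
    have h1 := hF lo 1 (2 * a) (by linarith) (fun _ => Real.exp_pos _) (fun _ => one_pos)
      (fun i => by simp [lo, ← Real.exp_add]) i
    have h2 := (ha i).2
    rw [mul_div_cancel_left₀ a two_ne_zero] at h1
    have h3 : 1 ≤ Real.exp a * (Real.exp a * F lo i) :=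
      h2.trans (mul_le_mul_of_nonneg_left h1 (Real.exp_pos a).le)
    rw [← mul_assoc, ← Real.exp_add, ← two_mul] at h3
    change Real.exp (-(2 * a)) ≤ F lo i
    rw [Real.exp_neg, inv_le_iff_one_le_mul₀ (Real.exp_pos _)]
    linarith
  have hhi : F hi ≤ hi := by
    intro i
    have h1 := hF 1 hi (2 * a) (by linarith) (fun _ => one_pos) (fun _ => Real.exp_pos _)
      (fun i => by simp [hi]) i
    rw [mul_div_cancel_left₀ a two_ne_zero] at h1
    have h3 := h1.trans (mul_le_mul_of_nonneg_left (ha i).1 (Real.exp_pos a).le)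
    rw [← Real.exp_add, ← two_mul] at h3
    exact h3
  have hposlo : ∀ u : Fin n → ℝ, lo ≤ u → ∀ i, 0 < u i := fun u hu i =>
    (Real.exp_pos _).trans_le (hu i)
  -- The case a = 0 of the contraction estimate is monotonicity, which the least fixed point needs.
  have hmono : ∀ u u' : Fin n → ℝ, lo ≤ u' → u' ≤ u → F u' ≤ F u := by
    intro u u' h1 h2 i
    have h3 := hF u u' 0 le_rfl (hposlo u (h1.trans h2)) (hposlo u' h1)
      (fun i => by simpa using h2 i) i
    simpa using h3
  have : Fact (lo ≤ hi) := ⟨hlohi⟩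
  let G : Set.Icc lo hi →o Set.Icc lo hi :=
    { toFun := fun u => ⟨F u.1, hlo.trans (hmono u.1 lo le_rfl u.2.1),
        (hmono hi u.1 u.2.1 u.2.2).trans hhi⟩
      monotone' := fun u' u h => hmono u.1 u'.1 u'.2.1 h }
  obtain ⟨u, hu⟩ : ∃ u : Set.Icc lo hi, G u = u := ⟨G.lfp, G.map_lfp⟩
  have hu : F u.1 = u.1 := congrArg Subtype.val hu
  have hrow : ∀ i, A i ≠ 0 → c i + r u.1 i = u.1 i := fun i hi => by
    have := congrFun hu i
    simpa only [F, if_neg hi] using this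
  refine ⟨fun i => if A i = 0 then 0 else r u.1 i, isRegLewis_iff.mpr ⟨fun i => ?_, fun i hi => ?_,
    fun i hi => ?_⟩⟩
  · split_ifs
    · exact le_rfl
    · exact hr0 _ _
  · simp [hi]
  · have hq : quad A (weightDiag q (c + fun i => if A i = 0 then 0 else r u.1 i)) i =
        quad A (weightDiag q u.1) i := by
      rw [quad, quad, gram_congr]
      intro j hj
      simp only [weightDiag, Pi.add_apply, if_neg hj, hrow j hj]
    rw [hq, if_neg hi]
    exact ⟨by linarith [hc i, hrpos u.1 i hi], hr u.1 i⟩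

theorem existsUnique_isRegLewis (hA : A.rank = d) (hq : 1 ≤ q) (hq' : q ≤ 2)
    (hc : ∀ i, 0 ≤ c i) : ∃! w, IsRegLewis A q c w := by
  obtain ⟨w, hw⟩ := exists_isRegLewis hA hq hq' hc
  exact ⟨w, hw, fun w' hw' => funext fun i =>
    le_antisymm (regLewis_le hA hq hq' hc hw hw' i) (regLewis_le hA hq hq' hc hw' hw i)⟩

end Iteration

/-! ### The iteration with errors -/

/-- `x` and `y` agree up to a factor `exp η`. -/
def LogNear (η x y : ℝ) : Prop := x ≤ Real.exp η * y ∧ y ≤ Real.exp η * x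

theorem le_exp_add {a b x y z : ℝ} (h : x ≤ Real.exp a * y) (h' : y ≤ Real.exp b * z) :
    x ≤ Real.exp (a + b) * z := by
  rw [Real.exp_add, mul_assoc]
  exact h.trans (mul_le_mul_of_nonneg_left h' (Real.exp_pos a).le)

theorem LogNear.trans {a b x y z : ℝ} (h : LogNear a x y) (h' : LogNear b y z) :
    LogNear (a + b) x z :=
  ⟨le_exp_add h.1 h'.1, add_comm b a ▸ le_exp_add h'.2 h.2⟩

theorem LogNear.mono {a b x y : ℝ} (h : LogNear a x y) (hab : a ≤ b) (hx : 0 ≤ x) (hy : 0 ≤ y) :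
    LogNear b x y := by
  have := Real.exp_le_exp.mpr hab
  exact ⟨h.1.trans (mul_le_mul_of_nonneg_right this hy),
    h.2.trans (mul_le_mul_of_nonneg_right this hx)⟩

theorem LogNear.pos {a x y : ℝ} (h : LogNear a x y) (hy : 0 < y) : 0 < x := by
  have := hy.trans_le h.2
  exact (pos_iff_pos_of_mul_pos this).mp (Real.exp_pos a)

theorem LogNear.const_add {a c x y : ℝ} (h : LogNear a x y) (ha : 0 ≤ a) (hc : 0 ≤ c) :
    LogNear a (c + x) (c + y) := by
  have h1 := mul_le_mul_of_nonneg_right (Real.one_le_exp ha) hc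
  constructor <;> rw [mul_add]
  · linarith [h.1]
  · linarith [h.2]

/-! ### Numerical solution of the scalar equation -/

section Scalar

variable {c θ p r : ℝ}

/-- The root z for c = 0 satisfies r ≤ z ≤ c + r, so c + z lies between c + r and 2(c + r).
Replacing (c + r)^θ by (c + z)^θ in r = p/(c + r)^θ costs at most 2^θ ≤ 2. -/
theorem initial_root_approx (hc : 0 ≤ c) (hθ : 0 ≤ θ) (hθ' : θ ≤ 1) (hp : 0 < p)
    (hr : 0 < r) (h : r * (c + r) ^ θ = p) :
    LogNear (Real.log 2) (p / (c + p ^ (1 / (1 + θ))) ^ θ) r := by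
  set z := p ^ (1 / (1 + θ)) with hz
  have hz0 : 0 < z := Real.rpow_pos_of_pos hp _
  have hzp : z * (0 + z) ^ θ = p := by
    rw [zero_add]
    nth_rewrite 1 [← Real.rpow_one z]
    rw [← Real.rpow_add hz0, hz, ← Real.rpow_mul hp.le, one_div_mul_cancel (by positivity),
      Real.rpow_one]
  have hrz : r ≤ z := by
    by_contra! hlt
    have h1 := scalar_root_lt le_rfl hθ hz0 hlt
    have h2 : (0 + r) ^ θ ≤ (c + r) ^ θ := Real.rpow_le_rpow (by linarith) (by linarith) hθ
    nlinarith
  have hzc : z ≤ c + r := by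
    by_contra! hlt
    have h1 := scalar_root_lt le_rfl hθ (by linarith : 0 < c + r) hlt
    have h2 : 0 < (0 + (c + r)) ^ θ := Real.rpow_pos_of_pos (by linarith) _
    rw [zero_add] at h1 h2
    nlinarith
  have hpos : 0 < (c + z) ^ θ := Real.rpow_pos_of_pos (by linarith) _
  rw [LogNear, Real.exp_log two_pos]
  constructor
  · rw [div_le_iff₀ hpos, ← h]
    have h1 : (c + r) ^ θ ≤ (c + z) ^ θ := Real.rpow_le_rpow (by linarith) (by linarith) hθ
    nlinarith
  · rw [mul_div_assoc', le_div_iff₀ hpos, ← h]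
    have h1 : (c + z) ^ θ ≤ (2 * (c + r)) ^ θ := Real.rpow_le_rpow (by linarith) (by linarith) hθ
    rw [Real.mul_rpow two_pos.le (by linarith)] at h1
    have h2 : (2 : ℝ) ^ θ ≤ 2 := by
      simpa using Real.rpow_le_rpow_of_exponent_le (one_le_two (α := ℝ)) hθ'
    have h3 : 0 < (c + r) ^ θ := Real.rpow_pos_of_pos (by linarith) _
    nlinarith

/-- For θ ≤ 1 the denominator grows no faster than the numerator. This monotonicity turns bounds on
an iterate into bounds on the next one. -/
theorem mul_rpow_shift_le {w v : ℝ} (hc : 0 ≤ c) (hθ' : θ ≤ 1)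
    (hw : 0 < w) (h : w ≤ v) : w / (c + w) ^ θ ≤ v / (c + v) ^ θ := by
  have h1 : 0 < c + w := by linarith
  have h2 : 0 < c + v := by linarith
  rw [div_le_div_iff₀ (Real.rpow_pos_of_pos h1 _) (Real.rpow_pos_of_pos h2 _)]
  have h3 : (c + v) ^ θ = ((c + v) / (c + w)) ^ θ * (c + w) ^ θ := by
    rw [← Real.mul_rpow (by positivity) h1.le, div_mul_cancel₀ _ h1.ne']
  have h4 : ((c + v) / (c + w)) ^ θ ≤ v / w := by
    calc ((c + v) / (c + w)) ^ θ ≤ ((c + v) / (c + w)) ^ (1 : ℝ) :=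
          Real.rpow_le_rpow_of_exponent_le (by rw [le_div_iff₀ h1]; linarith) hθ'
      _ ≤ v / w := by
          rw [Real.rpow_one, div_le_div_iff₀ h1 hw]
          nlinarith
  rw [h3, ← mul_assoc]
  refine mul_le_mul_of_nonneg_right ?_ (Real.rpow_nonneg h1.le _)
  rw [le_div_iff₀ hw] at h4
  linarith

/-- One step of the scalar iteration halves the logarithmic distance to the root. -/
theorem scalar_step_halves {w η : ℝ} (hc : 0 ≤ c) (hθ : 0 ≤ θ) (hθ' : θ ≤ 1)
    (hr : 0 < r) (h : r * (c + r) ^ θ = p) (hη : 0 ≤ η) (hw : LogNear η w r) :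
    LogNear (η / 2) ((w * p / (c + w) ^ θ) ^ (1 / 2 : ℝ)) r := by
  have hw0 := hw.pos hr
  have hE := Real.exp_pos η
  have hE1 := Real.one_le_exp hη
  have hr' : 0 < (c + r) ^ θ := Real.rpow_pos_of_pos (by linarith) _
  have hp : 0 < p := h ▸ mul_pos hr hr'
  have hsq : Real.exp (η / 2) ^ 2 = Real.exp η := by
    rw [← Real.exp_nat_mul]
    congr 1
    push_cast
    ring
  have e : w * p / (c + w) ^ θ = w / (c + w) ^ θ * p := by ring
  rw [← Real.sqrt_eq_rpow, e]
  constructor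
  · refine Real.sqrt_le_iff.mpr ⟨by positivity, ?_⟩
    rw [mul_pow, hsq]
    have h1 := mul_rpow_shift_le hc hθ' hw0 hw.1
    have h2 : (c + r) ^ θ ≤ (c + Real.exp η * r) ^ θ :=
      Real.rpow_le_rpow (by linarith) (by nlinarith) hθ
    have h3 : Real.exp η * r / (c + Real.exp η * r) ^ θ ≤ Real.exp η * r / (c + r) ^ θ :=
      div_le_div_of_nonneg_left (by positivity) hr' h2
    calc w / (c + w) ^ θ * p ≤ Real.exp η * r / (c + r) ^ θ * p :=
          mul_le_mul_of_nonneg_right (h1.trans h3) hp.le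
      _ = Real.exp η * r ^ 2 := by rw [← h]; field_simp
  · rw [← div_le_iff₀' (Real.exp_pos _)]
    refine Real.le_sqrt_of_sq_le ?_
    rw [div_pow, hsq]
    have hv : r / Real.exp η ≤ w := by rw [div_le_iff₀' hE]; exact hw.2
    have hv0 : 0 < r / Real.exp η := by positivity
    have hvr : r / Real.exp η ≤ r := div_le_self hr.le hE1
    have h1 := mul_rpow_shift_le hc hθ' hv0 hv
    have h2 : (c + r / Real.exp η) ^ θ ≤ (c + r) ^ θ :=
      Real.rpow_le_rpow (by linarith) (by linarith) hθ
    have h3 : r / Real.exp η / (c + r) ^ θ ≤ r / Real.exp η / (c + r / Real.exp η) ^ θ :=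
      div_le_div_of_nonneg_left hv0.le (Real.rpow_pos_of_pos (by linarith) _) h2
    calc r ^ 2 / Real.exp η = r / Real.exp η / (c + r) ^ θ * p := by rw [← h]; field_simp
      _ ≤ _ := mul_le_mul_of_nonneg_right (h3.trans h1) hp.le

end Scalar

/-! ### Propagation of errors through the Lewis weight iteration -/

section Iteration

variable {n d : ℕ} {A : Matrix (Fin n) (Fin d) ℝ} {q : ℝ} {c w : Fin n → ℝ}

/-- The vector `u` gives the quadratic forms of the Lewis reweighting up to a factor `exp b`. -/
def Approximates (A : Matrix (Fin n) (Fin d) ℝ) (q : ℝ) (c w : Fin n → ℝ) (b : ℝ)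
    (u : Fin n → ℝ) : Prop :=
  ∀ i, A i ≠ 0 →
    LogNear b (quad A (weightDiag q u) i) (quad A (weightDiag q (c + w)) i)

theorem IsRegLewis.weight_eq (h : IsRegLewis A q c w) {i : Fin n} (hi : A i ≠ 0) :
    w i = weightDiag q (c + w) i * quad A (weightDiag q (c + w)) i := by
  rw [weightDiag_of_pos (u := c + w) (h.pos i hi)]
  exact (h.eq i).trans (leverage_reweighted h.pos hi)

theorem IsRegLewis.le_one (hA : A.rank = d) (h : IsRegLewis A q c w) (i : Fin n) : w i ≤ 1 := by
  by_cases hi : A i = 0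
  · rw [(isRegLewis_iff.mp h).2.1 i hi]; exact zero_le_one
  · rw [h.weight_eq hi]
    exact mul_quad_le_one hA (weightDiag_pos q _) i

/-- Rows with w_j ≤ 1/(2n) together carry at most half of the Lewis energy, because D_j (a_j·x)² ≤
w_j E(x) by Cauchy–Schwarz. On the other rows c + 1 ≤ 2n (c + w), so D_j ≤ 2n D₀_j. Absorbing the
half gives the factor 4n. -/
theorem energy_le_start (hA : A.rank = d) (hn : 0 < n) (hq : 1 ≤ q) (hq' : q ≤ 2)
    (hc : ∀ i, 0 ≤ c i) (h : IsRegLewis A q c w) (x : Fin d → ℝ) :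
    energy A (weightDiag q (c + w)) x ≤ 4 * n * energy A (weightDiag q (c + 1)) x := by
  set D := weightDiag q (c + w) with hD
  set D₀ := weightDiag q (c + 1) with hD0
  have hn' : (1 : ℝ) ≤ n := by exact_mod_cast hn
  have hE := energy_nonneg (A := A) (weightDiag_pos q (c + w)) x
  have key : ∀ j, D j * (A j ⬝ᵥ x) ^ 2 ≤
      1 / (2 * n) * energy A D x + 2 * n * (D₀ j * (A j ⬝ᵥ x) ^ 2) := by
    intro j
    have hD0j : 0 ≤ D₀ j * (A j ⬝ᵥ x) ^ 2 := mul_nonneg (weightDiag_pos q _ j).le (sq_nonneg _)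
    by_cases hj : A j = 0
    · rw [hj, zero_dotProduct]
      have : 0 ≤ 1 / (2 * n) * energy A D x := by positivity
      simpa using this
    by_cases hw : w j ≤ 1 / (2 * n)
    · have h1 := mul_le_mul_of_nonneg_left (sq_dotProduct_le hA (weightDiag_pos q (c + w)) j x)
        (weightDiag_pos q (c + w) j).le
      have h2 := h.weight_eq hj
      rw [← hD] at h1 h2
      have h3 : D j * (energy A D x * quad A D j) = w j * energy A D x := by rw [h2]; ring
      rw [h3] at h1
      have h4 := mul_le_mul_of_nonneg_right hw hE
      have h5 : 0 ≤ 2 * n * (D₀ j * (A j ⬝ᵥ x) ^ 2) := by positivity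
      linarith
    · have hw := (not_le.mp hw).le
      rw [div_le_iff₀ (by positivity)] at hw
      have hlog : Real.exp (Real.log (2 * n)) = 2 * n := Real.exp_log (by positivity)
      have hle : (c + 1) j ≤ Real.exp (Real.log (2 * n)) * (c + w) j := by
        rw [hlog]
        simp only [Pi.add_apply, Pi.one_apply]
        nlinarith [hc j]
      have h1 := weightDiag_le_exp_mul hq hq' (h.pos j hj)
        (show 0 < (c + 1) j by simp only [Pi.add_apply, Pi.one_apply]; linarith [hc j]) hle
      have h2 : Real.exp (Real.log (2 * n) * (2 / q - 1)) ≤ 2 * n := by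
        nth_rewrite 2 [← hlog]
        refine Real.exp_le_exp.mpr (mul_le_of_le_one_right (Real.log_nonneg (by linarith))
          (exponent_le_one hq))
      have h3 : D j ≤ 2 * n * D₀ j :=
        h1.trans (mul_le_mul_of_nonneg_right h2 (weightDiag_pos q _ j).le)
      have h4 := mul_le_mul_of_nonneg_right h3 (sq_nonneg (A j ⬝ᵥ x))
      have h5 : 0 ≤ 1 / (2 * n) * energy A D x := by positivity
      linarith
  have hsum := Finset.sum_le_sum fun j (_ : j ∈ Finset.univ) => key j
  rw [Finset.sum_add_distrib, Finset.sum_const, Finset.card_univ,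
    Fintype.card_fin, nsmul_eq_mul] at hsum
  have e1 : (n : ℝ) * (1 / (2 * n) * energy A D x) = energy A D x / 2 := by field_simp
  have e2 : energy A D x ≤ energy A D x / 2 + 2 * n * energy A D₀ x := by
    rw [← e1]
    nth_rewrite 3 [energy]
    rw [Finset.mul_sum]
    exact hsum
  linarith

/-- The distance is measured between quadratic forms, since c + w can be arbitrarily small and c + 1
need not be near it. The other direction follows from w ≤ 1. -/
theorem approximates_start (hA : A.rank = d) (hn : 0 < n) (hq : 1 ≤ q) (hq' : q ≤ 2)
    (hc : ∀ i, 0 ≤ c i) (h : IsRegLewis A q c w) :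
    Approximates A q c w (Real.log (4 * n)) (c + 1) := by
  intro i hi
  have hn' : (1 : ℝ) ≤ n := by exact_mod_cast hn
  rw [LogNear, Real.exp_log (by positivity)]
  have hpos : ∀ i, 0 < (c + 1) i := fun i => by
    simp only [Pi.add_apply, Pi.one_apply]; linarith [hc i]
  refine ⟨quad_le_mul_of_energy_le hA (weightDiag_pos q _) (weightDiag_pos q _)
    (energy_le_start hA hn hq hq' hc h) i, ?_⟩
  have h1 := quad_weightDiag_le hA hq hq' (fun i _ => hpos i) h.pos (a := 0)
    (fun i _ => by simpa using h.le_one hA i) i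
  rw [zero_mul, Real.exp_zero, one_mul] at h1
  have h2 := quad_nonneg hA (weightDiag_pos q (c + 1)) i
  change quad A (weightDiag q (c + w)) i ≤ _ at h1
  nlinarith

/-- The first bound controls the output `w'` and has no damping; the second controls c + w', which
feeds the next round, and has the contraction factor 1/(1 + θ). -/
theorem regLewis_near_of_approximates (hA : A.rank = d) (hq : 1 ≤ q) (hq' : q ≤ 2)
    (hc : ∀ i, 0 ≤ c i)
    (h : IsRegLewis A q c w) {b ε η : ℝ} (hb : 0 ≤ b) (hε : 0 ≤ ε) (hη : 0 ≤ η) {u p w' : Fin n → ℝ}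
    (hu : Approximates A q c w b u) {i : Fin n} (hi : A i ≠ 0)
    (hp : LogNear ε (p i) (quad A (weightDiag q u) i))
    (hw' : ∀ r, 0 < r → r * (c i + r) ^ (2 / q - 1) = p i → LogNear η (w' i) r) :
    LogNear (b + ε + η) (w' i) (w i) ∧ LogNear ((b + ε) / (1 + (2 / q - 1)) + η)
      ((c + w') i) ((c + w) i) := by
  have hθ := exponent_nonneg hq hq'
  obtain ⟨h1, -, h3⟩ := isRegLewis_iff.mp h
  have hp0 := hp.pos (quad_pos hA (weightDiag_pos q u) hi)
  obtain ⟨r, hr0, hr⟩ := exists_scalar_root (hc i) hθ hp0.le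
  have hr0 := scalar_root_pos hr0 hr hp0
  have hwi : 0 < w i :=
    scalar_root_pos (h1 i) (h3 i hi).2 (quad_pos hA (weightDiag_pos q _) hi)
  have hpp := hp.trans (hu i hi)
  rw [← hr, ← (h3 i hi).2, add_comm ε b] at hpp
  have hbε : 0 ≤ b + ε := by linarith
  have hr1 : LogNear (b + ε) r (w i) :=
    ⟨scalar_root_le_exp (hc i) hθ hbε hwi hpp.1, scalar_root_le_exp (hc i) hθ hbε hr0 hpp.2⟩
  have hr2 : LogNear ((b + ε) / (1 + (2 / q - 1))) (c i + r) (c i + w i) :=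
    ⟨scalar_shifted_root_le_exp (hc i) hθ hbε hwi hpp.1,
      scalar_shifted_root_le_exp (hc i) hθ hbε hr0 hpp.2⟩
  have hwr := hw' r hr0 hr
  refine ⟨?_, ?_⟩
  · rw [add_comm]
    exact hwr.trans hr1
  · rw [add_comm]
    exact (hwr.const_add hη (hc i)).trans hr2

theorem approximates_step (hA : A.rank = d) (hq : 1 ≤ q) (hq' : q ≤ 2) (hc : ∀ i, 0 ≤ c i)
    (h : IsRegLewis A q c w) {b ε η : ℝ} (hb : 0 ≤ b) (hε : 0 ≤ ε) (hη : 0 ≤ η) {u p w' : Fin n → ℝ}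
    (hu : Approximates A q c w b u)
    (hp : ∀ i, A i ≠ 0 → LogNear ε (p i) (quad A (weightDiag q u) i))
    (hw' : ∀ i, A i ≠ 0 → ∀ r, 0 < r → r * (c i + r) ^ (2 / q - 1) = p i → LogNear η (w' i) r) :
    Approximates A q c w (b / 2 + ε + η) (c + w') := by
  intro i hi
  have hθ := exponent_nonneg hq hq'
  have hθ' := exponent_le_one hq
  have hnear := fun i hi => (regLewis_near_of_approximates hA hq hq' hc h hb hε hη hu hi
    (hp i hi) (hw' i hi)).2
  have hpos : ∀ i, A i ≠ 0 → 0 < (c + w') i := fun i hi => (hnear i hi).pos (h.pos i hi)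
  have hN : LogNear (((b + ε) / (1 + (2 / q - 1)) + η) * (2 / q - 1))
      (quad A (weightDiag q (c + w')) i) (quad A (weightDiag q (c + w)) i) :=
    ⟨quad_weightDiag_le hA hq hq' h.pos hpos (fun i hi => (hnear i hi).1) i,
      quad_weightDiag_le hA hq hq' hpos h.pos (fun i hi => (hnear i hi).2) i⟩
  refine hN.mono ?_ (quad_nonneg hA (weightDiag_pos q _) i) (quad_nonneg hA (weightDiag_pos q _) i)
  have h1 := half_contraction (by linarith : 0 ≤ b + ε) hθ hθ'
  have h2 : ((b + ε) / (1 + (2 / q - 1)) + η) * (2 / q - 1) =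
      (b + ε) * (2 / q - 1) / (1 + (2 / q - 1)) + η * (2 / q - 1) := by ring
  have h3 : η * (2 / q - 1) ≤ η := mul_le_of_le_one_right hη hθ'
  rw [h2]
  linarith

end Iteration

/-! ### Concentration of random sign sums -/

section Signs

/-- The mean of a function of `n` independent uniformly random bits. -/
noncomputable def bitMean {n : ℕ} (f : (Fin n → Bool) → ℝ) : ℝ := (∑ b, f b) / 2 ^ n

/-- The sum of the numbers `v i` with the signs given by the bits `b i`. -/
noncomputable def signSum {n : ℕ} (v : Fin n → ℝ) (b : Fin n → Bool) : ℝ :=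
  ∑ i, v i * if b i then 1 else -1

variable {n : ℕ}

theorem bitMean_mono {f g : (Fin n → Bool) → ℝ} (h : ∀ b, f b ≤ g b) : bitMean f ≤ bitMean g :=
  div_le_div_of_nonneg_right (Finset.sum_le_sum fun b _ => h b) (by positivity)

theorem bitMean_const_mul (r : ℝ) (f : (Fin n → Bool) → ℝ) :
    bitMean (fun b => r * f b) = r * bitMean f := by
  rw [bitMean, bitMean, ← Finset.mul_sum, mul_div_assoc]

theorem bitMean_add (f g : (Fin n → Bool) → ℝ) :
    bitMean (fun b => f b + g b) = bitMean f + bitMean g := by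
  rw [bitMean, bitMean, bitMean, Finset.sum_add_distrib, add_div]

theorem bitMean_sum {ι : Type*} (t : Finset ι) (f : ι → (Fin n → Bool) → ℝ) :
    bitMean (fun b => ∑ i ∈ t, f i b) = ∑ i ∈ t, bitMean (f i) := by
  simp only [bitMean]
  rw [Finset.sum_comm, Finset.sum_div]

theorem bitMean_const (r : ℝ) : bitMean (fun _ : Fin n → Bool => r) = r := by
  simp [bitMean]

theorem bitMean_succ (f : (Fin (n + 1) → Bool) → ℝ) :
    bitMean f = (bitMean (fun b => f (Fin.cons true b : Fin (n + 1) → Bool)) +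
      bitMean (fun b => f (Fin.cons false b : Fin (n + 1) → Bool))) / 2 := by
  have h := (Fin.consEquiv (fun _ : Fin (n + 1) => Bool)).sum_comp f
  rw [bitMean, bitMean, bitMean, ← h, Fintype.sum_prod_type, Fintype.sum_bool, pow_succ]
  change (∑ b, f (Fin.cons true b) + ∑ b, f (Fin.cons false b)) / _ = _
  field_simp

theorem signSum_cons (v : Fin (n + 1) → ℝ) (x : Bool) (b : Fin n → Bool) :
    signSum v (Fin.cons x b : Fin (n + 1) → Bool) =
      v 0 * (if x then 1 else -1) + signSum (fun i => v i.succ) b := by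
  simp [signSum, Fin.sum_univ_succ]

/-- The shift a absorbs the first sign, which makes induction on the number of signs possible. -/
theorem bitMean_add_signSum_sq : ∀ {n : ℕ} (v : Fin n → ℝ) (a : ℝ),
    bitMean (fun b => (a + signSum v b) ^ 2) = a ^ 2 + ∑ i, v i ^ 2
  | 0, v, a => by simp [bitMean, signSum]
  | n + 1, v, a => by
    rw [bitMean_succ, Fin.sum_univ_succ]
    simp only [signSum_cons, ← add_assoc]
    rw [bitMean_add_signSum_sq, bitMean_add_signSum_sq]
    simp only [if_true, Bool.false_eq_true, if_false]
    ring

theorem cosh_step {t a v : ℝ} (ht : 0 ≤ t) (htv : 2 * t * v ^ 2 < 1) :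
    (Real.exp (t * (a + v) ^ 2) + Real.exp (t * (a - v) ^ 2)) / 2 ≤
      1 / √(1 - 2 * t * v ^ 2) * Real.exp (t / (1 - 2 * t * v ^ 2) * a ^ 2) := by
  set y := 2 * t * v ^ 2 with hy
  have hy0 : 0 ≤ y := by positivity
  have hy1 : 0 < 1 - y := by linarith
  have h1 : (Real.exp (t * (a + v) ^ 2) + Real.exp (t * (a - v) ^ 2)) / 2 =
      Real.exp (t * a ^ 2 + y / 2) * Real.cosh (2 * t * a * v) := by
    rw [Real.cosh_eq, mul_div_assoc', mul_add, ← Real.exp_add, ← Real.exp_add]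
    congr 3 <;> rw [hy] <;> ring
  have h2 : Real.exp (y / 2) ≤ 1 / √(1 - y) := by
    have h3 : √(1 - y) ≤ Real.exp (-(y / 2)) := by
      refine Real.sqrt_le_iff.mpr ⟨(Real.exp_pos _).le, ?_⟩
      rw [← Real.exp_nat_mul]
      have := Real.add_one_le_exp (-y)
      rw [show ((2 : ℕ) : ℝ) * -(y / 2) = -y by push_cast; ring]
      linarith
    rw [le_div_iff₀ (Real.sqrt_pos.mpr hy1)]
    calc Real.exp (y / 2) * √(1 - y) ≤ Real.exp (y / 2) * Real.exp (-(y / 2)) :=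
          mul_le_mul_of_nonneg_left h3 (Real.exp_pos _).le
      _ = 1 := by rw [← Real.exp_add, add_neg_cancel, Real.exp_zero]
  have h4 : Real.cosh (2 * t * a * v) ≤ Real.exp (t * a ^ 2 * y) := by
    refine (Real.cosh_le_exp_half_sq _).trans_eq ?_
    congr 1
    rw [hy]
    ring
  have h5 : t * a ^ 2 + t * a ^ 2 * y ≤ t / (1 - y) * a ^ 2 := by
    rw [div_mul_eq_mul_div, le_div_iff₀ hy1]
    have : 0 ≤ t * a ^ 2 * y ^ 2 := by positivity
    nlinarith
  calc _ = Real.exp (t * a ^ 2 + y / 2) * Real.cosh (2 * t * a * v) := h1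
    _ ≤ Real.exp (t * a ^ 2 + y / 2) * Real.exp (t * a ^ 2 * y) :=
        mul_le_mul_of_nonneg_left h4 (Real.exp_pos _).le
    _ = Real.exp (y / 2) * Real.exp (t * a ^ 2 + t * a ^ 2 * y) := by
        rw [← Real.exp_add, ← Real.exp_add]
        congr 1
        ring
    _ ≤ _ := mul_le_mul h2 (Real.exp_le_exp.mpr h5) (Real.exp_pos _).le (by positivity)

/-- The exponential moments of the square of a sign sum are at most those of a Gaussian. -/
theorem bitMean_exp_sq_le : ∀ {n : ℕ} (v : Fin n → ℝ) (a t : ℝ), 0 ≤ t →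
    2 * t * ∑ i, v i ^ 2 < 1 →
    bitMean (fun b => Real.exp (t * (a + signSum v b) ^ 2)) ≤
      1 / √(1 - 2 * t * ∑ i, v i ^ 2) * Real.exp (t / (1 - 2 * t * ∑ i, v i ^ 2) * a ^ 2)
  | 0, v, a, t, _, _ => by simp [bitMean, signSum]
  | n + 1, v, a, t, ht, hV => by
    rw [Fin.sum_univ_succ] at hV
    rw [bitMean_succ, Fin.sum_univ_succ]
    simp only [signSum_cons, ← add_assoc, if_true, Bool.false_eq_true, if_false, mul_one,
      mul_neg, ← sub_eq_add_neg]
    set V := ∑ i : Fin n, v i.succ ^ 2 with hVdef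
    have hV0 : 0 ≤ V := Finset.sum_nonneg fun i _ => sq_nonneg _
    have hv : 0 ≤ t * v 0 ^ 2 := mul_nonneg ht (sq_nonneg _)
    have h1 : 2 * t * V < 1 := by nlinarith
    have h1' : 0 < 1 - 2 * t * V := by linarith
    have ih := fun a => bitMean_exp_sq_le (fun i => v i.succ) a t ht h1
    rw [← hVdef] at ih
    have h2 : 2 * (t / (1 - 2 * t * V)) * v 0 ^ 2 < 1 := by
      rw [mul_div_assoc', div_mul_eq_mul_div, div_lt_one h1']
      linarith
    have hs := cosh_step (a := a) (div_nonneg ht h1'.le) h2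
    -- Averaging over the later signs replaces t by t/(1 - 2tV); `cosh_step` with this parameter
    -- handles the first sign, and the Gaussian normalizing factors multiply.
    have e : 1 - 2 * t * (v 0 ^ 2 + V) =
        (1 - 2 * t * V) * (1 - 2 * (t / (1 - 2 * t * V)) * v 0 ^ 2) := by
      field_simp
      ring
    rw [e, Real.sqrt_mul h1'.le, ← div_div t]
    calc _ ≤ (1 / √(1 - 2 * t * V) * Real.exp (t / (1 - 2 * t * V) * (a + v 0) ^ 2) +
          1 / √(1 - 2 * t * V) * Real.exp (t / (1 - 2 * t * V) * (a - v 0) ^ 2)) / 2 :=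
          div_le_div_of_nonneg_right (add_le_add (ih _) (ih _)) two_pos.le
      _ = 1 / √(1 - 2 * t * V) * ((Real.exp (t / (1 - 2 * t * V) * (a + v 0) ^ 2) +
          Real.exp (t / (1 - 2 * t * V) * (a - v 0) ^ 2)) / 2) := by ring
      _ ≤ _ := mul_le_mul_of_nonneg_left hs (by positivity)
      _ = _ := by rw [one_div, one_div, one_div, mul_inv]; ring

variable {v : Fin n → ℝ} {p ε : ℝ}

theorem bitMean_signSum_sq (v : Fin n → ℝ) :
    bitMean (fun b => signSum v b ^ 2) = ∑ i, v i ^ 2 := by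
  simpa using bitMean_add_signSum_sq v 0

theorem bitMean_exp_div_le (hp : 0 < p) (hv : ∑ i, v i ^ 2 = p) {t : ℝ} (ht : 0 ≤ t)
    (ht' : 2 * t < 1) :
    bitMean (fun b => Real.exp (t * (signSum v b ^ 2 / p))) ≤ 1 / √(1 - 2 * t) := by
  have e : 2 * (t / p) * p = 2 * t := by field_simp
  have h := bitMean_exp_sq_le v 0 (t / p) (by positivity) (by rw [hv, e]; exact ht')
  rw [hv, e] at h
  simp only [zero_add, ne_eq, OfNat.ofNat_ne_zero, not_false_eq_true, zero_pow, mul_zero,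
    Real.exp_zero, mul_one] at h
  refine le_of_eq_of_le ?_ h
  congr 1
  ext b
  congr 1
  ring

theorem bitMean_sq_sq_le (hp : 0 < p) (hv : ∑ i, v i ^ 2 = p) :
    bitMean (fun b => (signSum v b ^ 2 / p) ^ 2) ≤ 16 / 3 := by
  -- With X the normalized square, of mean 1, comparing 1 + X/4 + X²/32 with exp(X/4), whose mean is
  -- at most √2 ≤ 17/12, bounds the mean of X² by 32(17/12 - 5/4) = 16/3.
  have h1 := bitMean_exp_div_le hp hv (t := 1 / 4) (by norm_num) (by norm_num)
  have h2 : bitMean (fun b => 1 + (1 / 4 * (1 / p) * signSum v b ^ 2 +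
      1 / 32 * (signSum v b ^ 2 / p) ^ 2)) ≤
      bitMean (fun b => Real.exp (1 / 4 * (signSum v b ^ 2 / p))) := bitMean_mono fun b => by
    have := Real.quadratic_le_exp_of_nonneg
      (show 0 ≤ 1 / 4 * (signSum v b ^ 2 / p) by positivity)
    refine le_of_eq_of_le ?_ this
    ring
  rw [bitMean_add, bitMean_const, bitMean_add, bitMean_const_mul, bitMean_const_mul,
    bitMean_signSum_sq, hv] at h2
  have h3 : 1 / 4 * (1 / p) * p = 1 / 4 := by field_simp
  have h4 : 1 / √(1 - 2 * (1 / 4) : ℝ) ≤ 17 / 12 := by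
    rw [div_le_iff₀ (Real.sqrt_pos.mpr (by norm_num)), ← div_le_iff₀' (by norm_num)]
    exact Real.le_sqrt_of_sq_le (by norm_num)
  linarith

/-- The product (1 - x + x²/2)(1 + x + x²/2) equals 1 + x⁴/4, which is at least 1. -/
theorem exp_neg_le_quadratic {x : ℝ} (hx : 0 ≤ x) : Real.exp (-x) ≤ 1 - x + x ^ 2 / 2 := by
  have h := Real.quadratic_le_exp_of_nonneg hx
  rw [Real.exp_neg, inv_le_iff_one_le_mul₀ (Real.exp_pos x)]
  have h1 : 0 ≤ 1 - x + x ^ 2 / 2 := by nlinarith [sq_nonneg (x - 1)]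
  have h2 := mul_le_mul_of_nonneg_left h h1
  nlinarith [sq_nonneg (x ^ 2)]

/-- The Gaussian factor (1 - ε/2)^(-1/2) is at most exp(ε/4 + ε²/8), against exp(-ε/4 - ε²/4) from
the threshold: the total -ε²/8 is below -ε²/12. -/
theorem bitMean_upper_tail (hp : 0 < p) (hv : ∑ i, v i ^ 2 = p) (hε : 0 < ε) (hε' : ε ≤ 1) :
    bitMean (fun b => Real.exp (ε / 4 * (signSum v b ^ 2 / p - (1 + ε)))) ≤
      Real.exp (-(ε ^ 2 / 12)) := by
  have h1 := bitMean_exp_div_le hp hv (t := ε / 4) (by positivity) (by linarith)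
  have h2 : 1 / √(1 - 2 * (ε / 4)) ≤ Real.exp (ε / 4 + ε ^ 2 / 8) := by
    have h3 : 0 < 1 - 2 * (ε / 4) := by linarith
    rw [div_le_iff₀ (Real.sqrt_pos.mpr h3), ← div_le_iff₀' (Real.exp_pos _), one_div,
      ← Real.exp_neg]
    refine Real.le_sqrt_of_sq_le ?_
    rw [← Real.exp_nat_mul]
    have h4 := Real.quadratic_le_exp_of_nonneg (show 0 ≤ ε / 2 + ε ^ 2 / 4 by positivity)
    rw [show ((2 : ℕ) : ℝ) * -(ε / 4 + ε ^ 2 / 8) = -(ε / 2 + ε ^ 2 / 4) by push_cast; ring,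
      Real.exp_neg, inv_le_iff_one_le_mul₀ (Real.exp_pos _)]
    have h5 := mul_le_mul_of_nonneg_left h4 h3.le
    refine le_trans ?_ h5
    nlinarith [pow_pos hε 2, pow_pos hε 3, pow_pos hε 4, mul_nonneg (pow_pos hε 2).le (sub_nonneg.mpr hε'), mul_nonneg (pow_pos hε 3).le (sub_nonneg.mpr hε'), mul_nonneg (pow_pos hε 4).le (sub_nonneg.mpr hε')]
  have e : ∀ b, Real.exp (ε / 4 * (signSum v b ^ 2 / p - (1 + ε))) =
      Real.exp (-(ε / 4 * (1 + ε))) * Real.exp (ε / 4 * (signSum v b ^ 2 / p)) := fun b => by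
    rw [← Real.exp_add]
    congr 1
    ring
  simp only [e]
  rw [bitMean_const_mul]
  refine (mul_le_mul_of_nonneg_left (h1.trans h2) (Real.exp_pos _).le).trans ?_
  rw [← Real.exp_add]
  refine Real.exp_le_exp.mpr ?_
  nlinarith [sq_nonneg ε]

/-- Here the second moment suffices: the mean of exp(-εX/4) is at most 1 - ε/4 + ε²/6, and the
threshold contributes ε/4 - ε²/4. -/
theorem bitMean_lower_tail (hp : 0 < p) (hv : ∑ i, v i ^ 2 = p) (hε : 0 < ε) :
    bitMean (fun b => Real.exp (ε / 4 * ((1 - ε) - signSum v b ^ 2 / p))) ≤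
      Real.exp (-(ε ^ 2 / 12)) := by
  have h1 := bitMean_sq_sq_le hp hv
  have h2 : bitMean (fun b => Real.exp (-(ε / 4 * (signSum v b ^ 2 / p)))) ≤
      bitMean (fun b => 1 + (-(ε / 4 * (1 / p)) * signSum v b ^ 2 +
        ε ^ 2 / 32 * (signSum v b ^ 2 / p) ^ 2)) := bitMean_mono fun b => by
    refine (exp_neg_le_quadratic (show 0 ≤ ε / 4 * (signSum v b ^ 2 / p) by positivity)).trans_eq ?_
    ring
  rw [bitMean_add, bitMean_const, bitMean_add, bitMean_const_mul, bitMean_const_mul,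
    bitMean_signSum_sq, hv] at h2
  have h3 : -(ε / 4 * (1 / p)) * p = -(ε / 4) := by field_simp
  have h4 : bitMean (fun b => Real.exp (-(ε / 4 * (signSum v b ^ 2 / p)))) ≤
      Real.exp (-(ε / 4) + ε ^ 2 / 6) := by
    have := Real.add_one_le_exp (-(ε / 4) + ε ^ 2 / 6)
    nlinarith [sq_nonneg ε]
  have e : ∀ b, Real.exp (ε / 4 * ((1 - ε) - signSum v b ^ 2 / p)) =
      Real.exp (ε / 4 * (1 - ε)) * Real.exp (-(ε / 4 * (signSum v b ^ 2 / p))) := fun b => by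
    rw [← Real.exp_add]
    congr 1
    ring
  simp only [e]
  rw [bitMean_const_mul]
  refine (mul_le_mul_of_nonneg_left h4 (Real.exp_pos _).le).trans ?_
  rw [← Real.exp_add]
  refine Real.exp_le_exp.mpr ?_
  nlinarith [sq_nonneg ε]

end Signs

open scoped ENNReal

/-! ### Expectations of random steps -/

section Probability

variable {α β : Type}

/-- The expectation of a nonnegative function. -/
noncomputable def expect (p : PMF α) (f : α → ℝ≥0∞) : ℝ≥0∞ := ∑' a, p a * f a

theorem expect_pure (a : α) (f : α → ℝ≥0∞) : expect (PMF.pure a) f = f a := by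
  rw [expect, tsum_eq_single a]
  · simp
  · intro b hb
    simp [PMF.pure_apply, hb]

theorem expect_bind (p : PMF α) (g : α → PMF β) (f : β → ℝ≥0∞) :
    expect (p.bind g) f = expect p fun a => expect (g a) f := by
  simp only [expect, PMF.bind_apply, ← ENNReal.tsum_mul_right, ← ENNReal.tsum_mul_left]
  rw [ENNReal.tsum_comm]
  simp only [mul_assoc]

theorem expect_map (p : PMF α) (g : α → β) (f : β → ℝ≥0∞) :
    expect (p.map g) f = expect p (f ∘ g) := by
  rw [PMF.map, expect_bind]
  congr 1
  ext a
  rw [Function.comp_apply, expect_pure, Function.comp_apply]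

theorem expect_mono {p : PMF α} {f g : α → ℝ≥0∞} (h : ∀ a, f a ≤ g a) :
    expect p f ≤ expect p g :=
  ENNReal.tsum_le_tsum fun a => mul_le_mul_right (h a) _

theorem expect_const_mul (p : PMF α) (r : ℝ≥0∞) (f : α → ℝ≥0∞) :
    expect p (fun a => r * f a) = r * expect p f := by
  simp only [expect, ← ENNReal.tsum_mul_left, mul_left_comm]

theorem expect_add (p : PMF α) (f g : α → ℝ≥0∞) :
    expect p (fun a => f a + g a) = expect p f + expect p g := by
  simp only [expect, mul_add, ENNReal.tsum_add]

theorem expect_const (p : PMF α) (r : ℝ≥0∞) : expect p (fun _ => r) = r := by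
  rw [expect, ENNReal.tsum_mul_right, p.tsum_coe, one_mul]

theorem expect_uniform {n : ℕ} {f : (Fin n → Bool) → ℝ} (hf : ∀ b, 0 ≤ f b) :
    expect (PMF.uniformOfFintype (Fin n → Bool)) (fun b => ENNReal.ofReal (f b)) =
      ENNReal.ofReal (bitMean f) := by
  rw [expect, tsum_fintype, bitMean, ENNReal.ofReal_div_of_pos (by positivity),
    ENNReal.ofReal_sum_of_nonneg fun b _ => hf b]
  simp only [PMF.uniformOfFintype_apply, ← Finset.mul_sum]
  rw [mul_comm, div_eq_mul_inv]
  simp [ENNReal.ofReal_pow]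

/-- The event `Q` fails with probability at most `δ`. -/
def Fails (p : PMF α) (Q : α → Prop) (δ : ℝ≥0∞) : Prop := p.toOuterMeasure {a | ¬ Q a} ≤ δ

theorem toOuterMeasure_le_one (p : PMF α) (s : Set α) : p.toOuterMeasure s ≤ 1 := by
  rw [PMF.toOuterMeasure_apply, ← p.tsum_coe]
  exact ENNReal.tsum_le_tsum fun a => Set.indicator_le_self _ _ a

theorem Fails.pure {a : α} {Q : α → Prop} (h : Q a) (δ : ℝ≥0∞) : Fails (PMF.pure a) Q δ := by
  classical
  rw [Fails, PMF.toOuterMeasure_pure_apply, if_neg (by simpa using h)]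
  exact zero_le

theorem Fails.mono {p : PMF α} {Q R : α → Prop} {δ δ' : ℝ≥0∞} (h : Fails p Q δ)
    (hQ : ∀ a, Q a → R a) (hδ : δ ≤ δ') : Fails p R δ' :=
  (p.toOuterMeasure.mono (s₁ := {a | ¬ R a}) fun a (ha : ¬ R a) hQa => ha (hQ a hQa)).trans
    (h.trans hδ)

theorem Fails.bind {p : PMF α} {g : α → PMF β} {Q : α → Prop} {R : β → Prop} {δ δ' : ℝ≥0∞}
    (h : Fails p Q δ) (h' : ∀ a, Q a → Fails (g a) R δ') : Fails (p.bind g) R (δ + δ') := by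
  classical
  rw [Fails, PMF.toOuterMeasure_bind_apply]
  calc _ ≤ expect p fun a => {a | ¬ Q a}.indicator 1 a + δ' := by
        refine expect_mono fun a => ?_
        by_cases ha : Q a
        · exact (h' a ha).trans le_add_self
        · rw [Set.indicator_of_mem (by exact ha)]
          exact (toOuterMeasure_le_one _ _).trans le_self_add
    _ = p.toOuterMeasure {a | ¬ Q a} + δ' := by
        rw [expect_add, expect_const, PMF.toOuterMeasure_apply, expect]
        congr 2
        ext a
        by_cases ha : Q a <;> simp [ha]
    _ ≤ δ + δ' := add_le_add_left h _

/-- Markov's inequality. -/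
theorem fails_of_expect_le {p : PMF α} {Q : α → Prop} {f : α → ℝ≥0∞} {δ : ℝ≥0∞}
    (hf : ∀ a, f a < 1 → Q a) (h : expect p f ≤ δ) : Fails p Q δ := by
  rw [Fails, PMF.toOuterMeasure_apply]
  refine le_trans (ENNReal.tsum_le_tsum fun a => ?_) h
  by_cases ha : Q a
  · simp [ha]
  · rw [Set.indicator_of_mem (by exact ha)]
    exact le_mul_of_one_le_right zero_le (not_lt.mp fun h => ha (hf a h))

theorem one_sub_le_of_fails {p : PMF α} {Q : α → Prop} {δ : ℝ≥0∞} (h : Fails p Q δ) :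
    1 - δ ≤ p.toOuterMeasure {a | Q a} := by
  rw [tsub_le_iff_right]
  have h1 : (1 : ℝ≥0∞) ≤ p.toOuterMeasure {a | Q a} + p.toOuterMeasure {a | ¬ Q a} := by
    rw [← p.tsum_coe, PMF.toOuterMeasure_apply, PMF.toOuterMeasure_apply, ← ENNReal.tsum_add]
    refine ENNReal.tsum_le_tsum fun a => ?_
    by_cases ha : Q a <;> simp [ha]
  exact h1.trans (add_le_add_right h _)

/-- The potential depends on the step number because the target for a sum of squares grows with the
number of samples. -/
theorem expect_repeatStep_le {f : α → PMF α} {Φ : ℕ → α → ℝ≥0∞} {ρ : ℝ≥0∞}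
    (h : ∀ k s, expect (f s) (Φ (k + 1)) ≤ ρ * Φ k s) (m : ℕ) :
    ∀ k s, expect (repeatStep f m s) (Φ (k + m)) ≤ ρ ^ m * Φ k s := by
  induction m with
  | zero => intro k s; rw [repeatStep, expect_pure, pow_zero, one_mul, add_zero]
  | succ m ih =>
    intro k s
    rw [repeatStep, expect_bind]
    calc _ ≤ expect (f s) fun a => ρ ^ m * Φ (k + 1) a :=
          expect_mono fun a => by
            have := ih (k + 1) a
            rwa [add_right_comm, add_assoc] at this
      _ = ρ ^ m * expect (f s) (Φ (k + 1)) := expect_const_mul _ _ _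
      _ ≤ ρ ^ m * (ρ * Φ k s) := mul_le_mul_right (h k s) _
      _ = ρ ^ (m + 1) * Φ k s := by rw [pow_succ, mul_assoc]

/-- A union bound over the rounds; the indexed invariant lets the accuracy improve from round to
round. -/
theorem Fails.repeatStep {f : α → PMF α} {Q : ℕ → α → Prop} {δ : ℝ≥0∞}
    (h : ∀ k s, Q k s → Fails (f s) (Q (k + 1)) δ) (m : ℕ) :
    ∀ k s, Q k s → Fails (repeatStep f m s) (Q (k + m)) (m * δ) := by
  induction m with
  | zero => intro k s hs; exact Fails.pure hs _
  | succ m ih =>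
    intro k s hs
    have h1 := (h k s hs).bind fun a ha => ih (k + 1) a ha
    rw [RegLewis.repeatStep]
    refine h1.mono (fun a ha => ?_) (le_of_eq ?_)
    · rwa [add_right_comm, add_assoc] at ha
    · push_cast
      ring

theorem eq_add_mul_of_mem_support_repeatStep {f : α → PMF α} {g : α → ℕ} {a : ℕ}
    (h : ∀ s, ∀ s' ∈ (f s).support, g s' = g s + a) (m : ℕ) :
    ∀ s, ∀ s' ∈ (repeatStep f m s).support, g s' = g s + m * a := by
  induction m with
  | zero => intro s s' hs'; simp [repeatStep] at hs'; simp [hs']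
  | succ m ih =>
    intro s s' hs'
    rw [repeatStep, PMF.mem_support_bind_iff] at hs'
    obtain ⟨t, ht, hs'⟩ := hs'
    rw [ih t s' hs', h s t ht]
    ring

end Probability

/-! ### The cost of a program -/

section Cost

/-- The number of calls to the solver. -/
def Prog.solveCount (n d : ℕ) : Prog → ℕ
  | .seq P Q => P.solveCount n d + Q.solveCount n d
  | .loop m P => m.eval n d * P.solveCount n d
  | .assignRow _ _ | .assignCol _ _ | .signs _ | .mulA _ _ | .mulAT _ _ | .reweight _ => 0
  | .solve _ _ => 1

/-- The number of times that the diagonal matrix is set. -/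
def Prog.reweightCount (n d : ℕ) : Prog → ℕ
  | .seq P Q => P.reweightCount n d + Q.reweightCount n d
  | .loop m P => m.eval n d * P.reweightCount n d
  | .assignRow _ _ | .assignCol _ _ | .signs _ | .mulA _ _ | .mulAT _ _ | .solve _ _ => 0
  | .reweight _ => 1

/-- The number of operations other than solves, if `A` has `z` nonzero entries. -/
def Prog.opCount (z n d : ℕ) : Prog → ℕ
  | .seq P Q => P.opCount z n d + Q.opCount z n d
  | .loop m P => m.size + m.eval n d * (1 + P.opCount z n d)
  | .assignRow _ e => n * e.size
  | .assignCol _ e => d * e.size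
  | .signs _ => n
  | .mulA _ _ => z + n + d
  | .mulAT _ _ => z + n + d
  | .reweight _ => n
  | .solve _ _ => 0

variable {n d : ℕ} {A : Matrix (Fin n) (Fin d) ℝ} {q : ℝ}

/-- Loop lengths depend only on n and d, so each count is exact on the whole support. This gives
worst-case rather than expected cost. -/
theorem Prog.solves_of_mem_support (P : Prog) : ∀ (s s' : State n d),
    s' ∈ (P.run A q s).support → s'.solves = s.solves + P.solveCount n d := by
  induction P with
  | seq P Q hP hQ =>
    intro s s' h
    rw [Prog.run, PMF.mem_support_bind_iff] at h
    obtain ⟨t, ht, h⟩ := h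
    rw [hQ t s' h, hP s t ht, Prog.solveCount, add_assoc]
  | loop m P hP =>
    intro s s' h
    rw [Prog.run] at h
    exact eq_add_mul_of_mem_support_repeatStep (g := State.solves)
      (fun s s' h => hP (s.charge 1) s' h) _ (s.charge m.size) s' h
  | signs k =>
    intro s s' h
    rw [Prog.run, PMF.mem_support_map_iff] at h
    obtain ⟨b, -, rfl⟩ := h
    rfl
  | _ =>
    intro s s' h
    rw [Prog.run, PMF.mem_support_pure_iff] at h
    subst h
    rfl

theorem Prog.reweights_of_mem_support (P : Prog) : ∀ (s s' : State n d),
    s' ∈ (P.run A q s).support → s'.reweights = s.reweights + P.reweightCount n d := by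
  induction P with
  | seq P Q hP hQ =>
    intro s s' h
    rw [Prog.run, PMF.mem_support_bind_iff] at h
    obtain ⟨t, ht, h⟩ := h
    rw [hQ t s' h, hP s t ht, Prog.reweightCount, add_assoc]
  | loop m P hP =>
    intro s s' h
    rw [Prog.run] at h
    exact eq_add_mul_of_mem_support_repeatStep (g := State.reweights)
      (fun s s' h => hP (s.charge 1) s' h) _ (s.charge m.size) s' h
  | signs k =>
    intro s s' h
    rw [Prog.run, PMF.mem_support_map_iff] at h
    obtain ⟨b, -, rfl⟩ := h
    rfl
  | _ =>
    intro s s' h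
    rw [Prog.run, PMF.mem_support_pure_iff] at h
    subst h
    rfl

theorem Prog.ops_of_mem_support (P : Prog) : ∀ (s s' : State n d),
    s' ∈ (P.run A q s).support → s'.ops = s.ops + P.opCount (nnz A) n d := by
  induction P with
  | seq P Q hP hQ =>
    intro s s' h
    rw [Prog.run, PMF.mem_support_bind_iff] at h
    obtain ⟨t, ht, h⟩ := h
    rw [hQ t s' h, hP s t ht, Prog.opCount, add_assoc]
  | loop m P hP =>
    intro s s' h
    rw [Prog.run] at h
    rw [eq_add_mul_of_mem_support_repeatStep (g := State.ops)
      (fun s s' h => (hP (s.charge 1) s' h).trans (add_assoc s.ops 1 _)) _ _ s' h,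
      Prog.opCount, ← add_assoc]
    rfl
  | signs k =>
    intro s s' h
    rw [Prog.run, PMF.mem_support_map_iff] at h
    obtain ⟨b, -, rfl⟩ := h
    rfl
  | _ =>
    intro s s' h
    rw [Prog.run, PMF.mem_support_pure_iff] at h
    subst h
    rfl

end Cost

/-! ### Hoare triples with failure probabilities -/

section Triple

variable {n d : ℕ} {A : Matrix (Fin n) (Fin d) ℝ} {q : ℝ}

/-- From a state with property `Q`, the program ends in a state with property `R`, except with
probability at most `δ`. -/
def Triple (A : Matrix (Fin n) (Fin d) ℝ) (q : ℝ) (P : Prog) (Q R : State n d → Prop)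
    (δ : ℝ≥0∞) : Prop :=
  ∀ s, Q s → Fails (P.run A q s) R δ

theorem Triple.seq {P P' : Prog} {Q R S : State n d → Prop} {δ δ' : ℝ≥0∞}
    (h : Triple A q P Q R δ) (h' : Triple A q P' R S δ') :
    Triple A q (.seq P P') Q S (δ + δ') := fun s hs => (h s hs).bind h'

/-- A first step that cannot fail. -/
theorem Triple.then {P P' : Prog} {Q R S : State n d → Prop} {δ : ℝ≥0∞}
    (h : Triple A q P Q R 0) (h' : Triple A q P' R S δ) :
    Triple A q (.seq P P') Q S δ := zero_add δ ▸ h.seq h'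

theorem Triple.assignRow {k : ℕ} {e : Expr} {Q R : State n d → Prop}
    (h : ∀ s, Q s → R { s with
      row := Function.update s.row k (fun i => e.eval q (fun l => s.row l i))
      ops := s.ops + n * e.size }) :
    Triple A q (.assignRow k e) Q R 0 := fun s hs => Fails.pure (h s hs) 0

theorem Triple.reweight {k : ℕ} {Q R : State n d → Prop}
    (h : ∀ s, Q s → R { s with
      diag := s.row k
      reweights := s.reweights + 1
      ops := s.ops + n }) :
    Triple A q (.reweight k) Q R 0 := fun s hs => Fails.pure (h s hs) 0

theorem Triple.loop {m : Count} {P : Prog} {Q : ℕ → State n d → Prop} {δ : ℝ≥0∞}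
    (h : ∀ k, Triple A q P (Q k) (Q (k + 1)) δ)
    (hQ : ∀ k s a, Q k s → Q k (s.charge a)) :
    Triple A q (.loop m P) (Q 0) (Q (m.eval n d)) (m.eval n d * δ) := fun s hs => by
  have h1 := Fails.repeatStep (f := fun s' : State n d => P.run A q (s'.charge 1))
    (fun k s hs => h k _ (hQ k s 1 hs)) (m.eval n d) 0 (s.charge m.size) (hQ 0 s _ hs)
  rw [zero_add] at h1
  exact h1

end Triple

/-! ### Estimating the quadratic forms by random signs -/

/-- One sample: row register `5` becomes `A (Aᵀ D A)⁻¹ Aᵀ D^(1/2)` times a vector of random signs,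
its squares are added to row register `3`, and row register `4` counts the samples. -/
def sampleProg : Prog :=
  .seq (.signs 5) <|
  .seq (.assignRow 5 (.mul (.reg 5) (.pow (.reg 2) (.const (1 / 2))))) <|
  .seq (.mulAT 0 5) <|
  .seq (.solve 0 0) <|
  .seq (.mulA 5 0) <|
  .seq (.assignRow 3 (.add (.reg 3) (.mul (.reg 5) (.reg 5)))) <|
  .assignRow 4 (.add (.reg 4) (.const 1))

section Sample

variable {n d : ℕ} {A : Matrix (Fin n) (Fin d) ℝ} {q : ℝ}

/-- The vector whose random signed sum is the `i`-th coordinate of a sample. -/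
noncomputable def sampleVec (A : Matrix (Fin n) (Fin d) ℝ) (D : Fin n → ℝ) (i j : Fin n) : ℝ :=
  √(D j) * (A j ⬝ᵥ ((gram A D)⁻¹ *ᵥ A i))

/-- With `bitMean_signSum_sq` this says that a squared sample coordinate is an unbiased estimate of
the quadratic form. -/
theorem sum_sampleVec_sq {D : Fin n → ℝ} (hA : A.rank = d) (hD : ∀ i, 0 < D i) (i : Fin n) :
    ∑ j, sampleVec A D i j ^ 2 = quad A D i := by
  rw [quad_eq_energy hA hD, energy]
  refine Finset.sum_congr rfl fun j _ => ?_
  rw [sampleVec, mul_pow, Real.sq_sqrt (hD j).le]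

theorem mulVec_inv_mulVec_transpose (D t : Fin n → ℝ) (i : Fin n) :
    (A *ᵥ ((gram A D)⁻¹ *ᵥ (Aᵀ *ᵥ t))) i = ∑ j, t j * (A j ⬝ᵥ ((gram A D)⁻¹ *ᵥ A i)) := by
  have hs : ((gram A D)⁻¹)ᵀ = (gram A D)⁻¹ := by
    rw [Matrix.transpose_nonsing_inv, gram_isSymm]
  change A i ⬝ᵥ ((gram A D)⁻¹ *ᵥ (Aᵀ *ᵥ t)) = _
  rw [Matrix.dotProduct_mulVec, ← Matrix.mulVec_transpose, hs, Matrix.dotProduct_mulVec,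
    Matrix.vecMul_transpose, dotProduct_comm]
  rfl

theorem sampleVec_eq_zero {D : Fin n → ℝ} {i : Fin n} (hi : A i = 0) (b : Fin n → Bool) :
    signSum (sampleVec A D i) b = 0 := by
  simp [signSum, sampleVec, hi]

/-- The effect of a sample with the signs `b` on the row registers. -/
noncomputable def sampleRows (A : Matrix (Fin n) (Fin d) ℝ) (D : Fin n → ℝ)
    (row : ℕ → Fin n → ℝ) (b : Fin n → Bool) : ℕ → Fin n → ℝ :=
  let x := fun i => signSum (sampleVec A D i) b
  Function.update (Function.update (Function.update row 5 x) 3 (row 3 + x * x)) 4 (row 4 + 1)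

/-- Signs are the only randomness, so program expectations reduce to means over bits. Only the row
registers and the diagonal matter for later steps. -/
theorem expect_sampleProg {D : Fin n → ℝ} (hD : ∀ i, 0 < D i) {s : State n d} (h2 : s.row 2 = D)
    (hdiag : s.diag = D) {Φ : (ℕ → Fin n → ℝ) → (Fin n → ℝ) → ℝ≥0∞} :
    expect (sampleProg.run A q s) (fun s' => Φ s'.row s'.diag) =
      expect (PMF.uniformOfFintype (Fin n → Bool)) fun b => Φ (sampleRows A D s.row b) D := by
  simp only [sampleProg, Prog.run, PMF.pure_bind, expect_bind, expect_map, expect_pure]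
  congr 1
  ext b
  simp only [Function.comp_apply]
  subst h2
  have hx : (A *ᵥ ((Aᵀ * Matrix.diagonal (s.row 2) * A)⁻¹ *ᵥ (Aᵀ *ᵥ fun i =>
      if b i = true then s.row 2 i ^ (2⁻¹ : ℝ) else -s.row 2 i ^ (2⁻¹ : ℝ)))) =
      fun i => signSum (sampleVec A (s.row 2) i) b := by
    ext i
    rw [← gram, mulVec_inv_mulVec_transpose, signSum]
    refine Finset.sum_congr rfl fun j _ => ?_
    rw [sampleVec, Real.sqrt_eq_rpow, one_div]
    split_ifs <;> ring
  rw [hdiag]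
  congr 1
  simp [Expr.eval, solution, hD, -Matrix.mulVec_mulVec]
  rw [hx]
  rfl

open Classical in
/-- The exponential potential that bounds the deviation of the sums `S` of `k` squares. -/
noncomputable def potential (A : Matrix (Fin n) (Fin d) ℝ) (p : Fin n → ℝ) (ε : ℝ) (k : ℕ)
    (S : Fin n → ℝ) : ℝ :=
  ∑ i, if A i = 0 then 0 else
    Real.exp (ε / 4 * (S i / p i - (1 + ε) * k)) + Real.exp (ε / 4 * ((1 - ε) * k - S i / p i))

theorem potential_nonneg (p : Fin n → ℝ) (ε : ℝ) (k : ℕ) (S : Fin n → ℝ) :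
    0 ≤ potential A p ε k S :=
  Finset.sum_nonneg fun i _ => by split_ifs <;> positivity

theorem potential_zero_le (p : Fin n → ℝ) (ε : ℝ) : potential A p ε 0 0 ≤ 2 * n := by
  calc potential A p ε 0 0 ≤ ∑ _i : Fin n, (2 : ℝ) := Finset.sum_le_sum fun i _ => by
        split_ifs
        · exact two_pos.le
        · norm_num
    _ = 2 * n := by simp [mul_comm]

/-- A new sample multiplies each exponential by an independent factor whose mean the two tail bounds
control, so the potential is a supermartingale even after gaining exp(ε²/12) per step. -/
theorem bitMean_potential_le {D : Fin n → ℝ} (hA : A.rank = d) (hD : ∀ i, 0 < D i) {ε : ℝ}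
    (hε : 0 < ε) (hε' : ε ≤ 1) (k : ℕ) (S : Fin n → ℝ) :
    bitMean (fun b => potential A (quad A D) ε (k + 1)
      (fun i => S i + signSum (sampleVec A D i) b ^ 2)) ≤
      Real.exp (-(ε ^ 2 / 12)) * potential A (quad A D) ε k S := by
  simp only [potential]
  rw [bitMean_sum, Finset.mul_sum]
  refine Finset.sum_le_sum fun i _ => ?_
  split_ifs with hi
  · rw [bitMean_const, mul_zero]
  have hp := quad_pos hA hD hi
  have h1 := bitMean_upper_tail hp (sum_sampleVec_sq hA hD i) hε hε'
  have h2 := bitMean_lower_tail hp (sum_sampleVec_sq hA hD i) hε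
  have e1 : ∀ b, Real.exp (ε / 4 * ((S i + signSum (sampleVec A D i) b ^ 2) / quad A D i -
      (1 + ε) * (k + 1 : ℕ))) = Real.exp (ε / 4 * (S i / quad A D i - (1 + ε) * k)) *
      Real.exp (ε / 4 * (signSum (sampleVec A D i) b ^ 2 / quad A D i - (1 + ε))) := fun b => by
    rw [← Real.exp_add]
    congr 1
    push_cast
    ring
  have e2 : ∀ b, Real.exp (ε / 4 * ((1 - ε) * (k + 1 : ℕ) -
      (S i + signSum (sampleVec A D i) b ^ 2) / quad A D i)) =
      Real.exp (ε / 4 * ((1 - ε) * k - S i / quad A D i)) *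
      Real.exp (ε / 4 * ((1 - ε) - signSum (sampleVec A D i) b ^ 2 / quad A D i)) := fun b => by
    rw [← Real.exp_add]
    congr 1
    push_cast
    ring
  simp only [e1, e2]
  rw [bitMean_add, bitMean_const_mul, bitMean_const_mul, mul_add,
    mul_comm (Real.exp (-(ε ^ 2 / 12))), mul_comm (Real.exp (-(ε ^ 2 / 12)))]
  exact add_le_add (mul_le_mul_of_nonneg_left h1 (Real.exp_pos _).le)
    (mul_le_mul_of_nonneg_left h2 (Real.exp_pos _).le)

/-- The terms are nonnegative, so each exponential is below 1 and has negative exponent. Summing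
over rows inside the potential does the work of the union bound. -/
theorem close_of_potential_lt_one {p : Fin n → ℝ} {ε : ℝ} (hε : 0 < ε) {k : ℕ} {S : Fin n → ℝ}
    (h : potential A p ε k S < 1) {i : Fin n} (hi : A i ≠ 0) (hp : 0 < p i) :
    (1 - ε) * k * p i ≤ S i ∧ S i ≤ (1 + ε) * k * p i := by
  classical
  have h1 : Real.exp (ε / 4 * (S i / p i - (1 + ε) * k)) +
      Real.exp (ε / 4 * ((1 - ε) * k - S i / p i)) < 1 := by
    refine lt_of_le_of_lt ?_ h
    rw [potential]
    refine le_trans (le_of_eq ?_) (Finset.single_le_sum (fun j _ => ?_) (Finset.mem_univ i))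
    · rw [if_neg hi]
    · split_ifs <;> positivity
  have h2 := Real.exp_pos (ε / 4 * (S i / p i - (1 + ε) * k))
  have h3 := Real.exp_pos (ε / 4 * ((1 - ε) * k - S i / p i))
  have h4 : ε / 4 * (S i / p i - (1 + ε) * k) < 0 := Real.exp_lt_one_iff.mp (by linarith)
  have h5 : ε / 4 * ((1 - ε) * k - S i / p i) < 0 := Real.exp_lt_one_iff.mp (by linarith)
  have h6 := neg_of_mul_neg_right h4 (by positivity)
  have h7 := neg_of_mul_neg_right h5 (by positivity)
  constructor
  · rw [← le_div_iff₀ hp]; linarith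
  · rw [← div_le_iff₀ hp]; linarith

/-- The content of the registers after `k` samples for the diagonal `D`. -/
structure Sampling (A : Matrix (Fin n) (Fin d) ℝ) (c D : Fin n → ℝ) (k : ℕ)
    (row : ℕ → Fin n → ℝ) (diag : Fin n → ℝ) : Prop where
  reg : row 0 = c
  scale : row 2 = D
  diag : diag = D
  count : row 4 = fun _ => (k : ℝ)
  zero : ∀ i, A i = 0 → row 3 i = 0

theorem Sampling.step {c D : Fin n → ℝ} {k : ℕ} {row : ℕ → Fin n → ℝ} {diag : Fin n → ℝ}
    (h : Sampling A c D k row diag) (b : Fin n → Bool) :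
    Sampling A c D (k + 1) (sampleRows A D row b) D where
  reg := by simp [sampleRows, h.reg]
  scale := by simp [sampleRows, h.scale]
  diag := rfl
  count := by
    ext i
    simp [sampleRows, h.count]
  zero i hi := by simp [sampleRows, h.zero i hi, sampleVec_eq_zero hi]

theorem triple_samples {c D : Fin n → ℝ} (hA : A.rank = d) (hD : ∀ i, 0 < D i) {ε : ℝ}
    (hε : 0 < ε) (hε' : ε ≤ 1) (m : Count) :
    Triple A q (.loop m sampleProg)
      (fun s => Sampling A c D 0 s.row s.diag ∧ s.row 3 = 0)
      (fun s => Sampling A c D (m.eval n d) s.row s.diag ∧ ∀ i, A i ≠ 0 →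
        (1 - ε) * m.eval n d * quad A D i ≤ s.row 3 i ∧
          s.row 3 i ≤ (1 + ε) * m.eval n d * quad A D i)
      (ENNReal.ofReal (Real.exp (-(ε ^ 2 / 12)) ^ m.eval n d * (2 * n))) := by
  classical
  intro s hs
  set ρ := Real.exp (-(ε ^ 2 / 12)) with hρ
  have hρ0 : 0 < ρ := Real.exp_pos _
  -- The value ⊤ outside the register invariant makes Markov's inequality deliver the invariant and
  -- the deviation bounds together.
  let Φ : ℕ → State n d → ℝ≥0∞ := fun k s =>
    if Sampling A c D k s.row s.diag then
      ENNReal.ofReal (potential A (quad A D) ε k (s.row 3)) else ⊤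
  have hstep : ∀ k s, expect (sampleProg.run A q (s.charge 1)) (Φ (k + 1)) ≤
      ENNReal.ofReal ρ * Φ k s := by
    intro k s
    by_cases hk : Sampling A c D k s.row s.diag
    · have h1 := expect_sampleProg (A := A) (q := q) hD (s := s.charge 1) hk.scale hk.diag
        (Φ := fun row diag => if Sampling A c D (k + 1) row diag then
          ENNReal.ofReal (potential A (quad A D) ε (k + 1) (row 3)) else ⊤)
      refine h1.trans_le ?_
      simp only [Φ, if_pos hk]
      have h2 : ∀ b, sampleRows A D (s.charge 1).row b 3 =
          fun i => s.row 3 i + signSum (sampleVec A D i) b ^ 2 := fun b => by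
        ext i
        simp [sampleRows, State.charge, sq]
      have h3 : ∀ b, Sampling A c D (k + 1) (sampleRows A D (s.charge 1).row b) D := hk.step
      simp only [h3, if_true, h2]
      rw [expect_uniform fun b => potential_nonneg _ _ _ _, ← ENNReal.ofReal_mul hρ0.le]
      exact ENNReal.ofReal_le_ofReal (bitMean_potential_le hA hD hε hε' k _)
    · simp only [Φ, if_neg hk]
      rw [ENNReal.mul_top (by simpa using hρ0)]
      exact le_top
  have hloop := expect_repeatStep_le hstep (m.eval n d) 0 (s.charge m.size)
  rw [zero_add] at hloop
  refine fails_of_expect_le (f := Φ (m.eval n d)) (fun a ha => ?_) (hloop.trans ?_)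
  · by_cases hk : Sampling A c D (m.eval n d) a.row a.diag
    · simp only [Φ, if_pos hk, ENNReal.ofReal_lt_one] at ha
      exact ⟨hk, fun i hi => close_of_potential_lt_one hε ha hi (quad_pos hA hD hi)⟩
    · simp [Φ, if_neg hk] at ha
  · have h0 : Φ 0 (s.charge m.size) = ENNReal.ofReal (potential A (quad A D) ε 0 0) := by
      rw [← hs.2]
      exact if_pos hs.1
    rw [h0, ENNReal.ofReal_mul (by positivity), ENNReal.ofReal_pow hρ0.le]
    exact mul_le_mul_right (ENNReal.ofReal_le_ofReal (potential_zero_le _ _)) _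

end Sample

/-! ### The algorithm -/

/-- The exponent `2 / q - 1`. -/
def exponentExpr : Expr := .sub (.div (.const 2) .expo) (.const 1)

/-- The diagonal `u ^ (1 - 2 / q)` for the vector `u` in row register `1`. -/
def diagExpr : Expr :=
  .ifLe (.reg 1) (.const 0) (.const 1) (.pow (.reg 1) (.sub (.const 1) (.div (.const 2) .expo)))

/-- The first approximation of the root `w` of `w (c + w) ^ (2 / q - 1) = p`. -/
def startExpr : Expr :=
  .div (.reg 3) (.pow (.add (.reg 0) (.pow (.reg 3) (.div (.const 1) (.add (.const 1) exponentExpr))))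
    exponentExpr)

/-- The improved approximation of the root `w` of `w (c + w) ^ (2 / q - 1) = p`. -/
def improveExpr : Expr :=
  .pow (.div (.mul (.reg 6) (.reg 3)) (.pow (.add (.reg 0) (.reg 6)) exponentExpr)) (.const (1 / 2))

/-- Set the diagonal of the solver for the vector in row register `1`, and clear the registers for
the samples. -/
def setupProg : Prog :=
  .seq (.assignRow 2 diagExpr) <|
  .seq (.reweight 2) <|
  .seq (.assignRow 3 (.const 0)) <|
  .assignRow 4 (.const 0)

/-- Compute new weights in row register `6` from the sums of the samples. -/
def updateProg : Prog :=
  .seq (.assignRow 3 (.div (.reg 3) (.reg 4))) <|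
  .seq (.assignRow 6 startExpr) <|
  .seq (.loop (.const 10) (.assignRow 6 improveExpr)) <|
  .assignRow 1 (.add (.reg 0) (.reg 6))

/-- One round of the Lewis weight iteration, with `m` samples. -/
def roundProg (m : Count) : Prog :=
  .seq setupProg <| .seq (.loop m sampleProg) updateProg

/-- The algorithm with `l` rounds of `m` samples. -/
def lewisProg (l m : Count) : Prog :=
  .seq (.assignRow 1 (.add (.reg 0) (.const 1))) <|
  .seq (.loop l (roundProg m)) <|
  .assignRow 0 (.reg 6)

/-! ### Verification of the program -/

section Correctness

variable {n d : ℕ} {A : Matrix (Fin n) (Fin d) ℝ} {q : ℝ} {c w : Fin n → ℝ}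

theorem triple_setup {u : Fin n → ℝ} :
    Triple A q setupProg (fun s => s.row 0 = c ∧ s.row 1 = u)
      (fun s => Sampling A c (weightDiag q u) 0 s.row s.diag ∧ s.row 3 = 0) 0 := by
  refine Triple.then (R := fun s => s.row 0 = c ∧ s.row 2 = weightDiag q u)
    (Triple.assignRow ?_) ?_
  · rintro s ⟨h0, h1⟩
    refine ⟨by simpa using h0, ?_⟩
    ext i
    simp only [Function.update_self, diagExpr, Expr.eval, h1, weightDiag, Rat.cast_zero,
      Rat.cast_one, Rat.cast_ofNat]
    split_ifs with h2 h3
    · rfl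
    · rfl
    · exact absurd (not_le.mp h2) h3
  refine Triple.then (R := fun s => s.row 0 = c ∧ s.row 2 = weightDiag q u ∧
    s.diag = weightDiag q u) (Triple.reweight fun s h => ⟨h.1, h.2, h.2⟩) ?_
  refine Triple.then (R := fun s => s.row 0 = c ∧ s.row 2 = weightDiag q u ∧
    s.diag = weightDiag q u ∧ s.row 3 = 0) (Triple.assignRow ?_) (Triple.assignRow ?_)
  · rintro s ⟨h0, h2, hd⟩
    refine ⟨by simpa using h0, by simpa using h2, hd, ?_⟩
    ext i
    simp [Expr.eval]
  · rintro s ⟨h0, h2, hd, h3⟩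
    refine ⟨⟨by simpa using h0, by simpa using h2, hd, ?_, fun i _ => ?_⟩, by simpa using h3⟩
    · ext i
      simp [Expr.eval]
    · simp [h3]

/-- The weights in row register `6` are approximate roots for the values in row register `3`. -/
def RootsNear (A : Matrix (Fin n) (Fin d) ℝ) (q : ℝ) (c : Fin n → ℝ) (η : ℝ)
    (p w' : Fin n → ℝ) : Prop :=
  (∀ i, A i = 0 → w' i = 0) ∧
    ∀ i, A i ≠ 0 → ∀ r, 0 < r → r * (c i + r) ^ (2 / q - 1) = p i → LogNear η (w' i) r

theorem exponentExpr_eval (v : ℕ → ℝ) : exponentExpr.eval q v = 2 / q - 1 := by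
  simp [exponentExpr, Expr.eval]

theorem eval_startExpr (hq : 1 ≤ q) (hq' : q ≤ 2) {v : ℕ → ℝ} (hc : 0 ≤ v 0) {r : ℝ} (hr : 0 < r)
    (h : r * (v 0 + r) ^ (2 / q - 1) = v 3) :
    LogNear (Real.log 2) (startExpr.eval q v) r := by
  have hp : 0 < v 3 := h ▸ mul_pos hr (Real.rpow_pos_of_pos (by linarith) _)
  have h1 := initial_root_approx hc (exponent_nonneg hq hq') (exponent_le_one hq) hp hr h
  have h2 : 0 < v 0 + v 3 ^ (1 / (1 + (2 / q - 1))) := by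
    have := Real.rpow_pos_of_pos hp (1 / (1 + (2 / q - 1)))
    linarith
  simp only [startExpr, Expr.eval, exponentExpr_eval, Rat.cast_one, if_pos hp, if_pos h2]
  exact h1

theorem eval_improveExpr (hq : 1 ≤ q) (hq' : q ≤ 2) {v : ℕ → ℝ} (hc : 0 ≤ v 0) {r η : ℝ}
    (hη : 0 ≤ η) (hr : 0 < r) (h : r * (v 0 + r) ^ (2 / q - 1) = v 3)
    (hw : LogNear η (v 6) r) :
    LogNear (η / 2) (improveExpr.eval q v) r := by
  have hp : 0 < v 3 := h ▸ mul_pos hr (Real.rpow_pos_of_pos (by linarith) _)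
  have hw0 := hw.pos hr
  have h1 : 0 < v 0 + v 6 := by linarith
  have h2 : 0 < v 6 * v 3 / (v 0 + v 6) ^ (2 / q - 1) :=
    div_pos (mul_pos hw0 hp) (Real.rpow_pos_of_pos h1 _)
  simp only [improveExpr, Expr.eval, exponentExpr_eval, if_pos h1, if_pos h2]
  have h3 := scalar_step_halves hc (exponent_nonneg hq hq') (exponent_le_one hq) hr h hη hw
  norm_num at h3 ⊢
  exact h3

/-- The predicate `B` passes accuracy of the averages through unchanged, which keeps this
deterministic part independent of the sampling. -/
theorem triple_update (hq : 1 ≤ q) (hq' : q ≤ 2) (hc : ∀ i, 0 ≤ c i) {D : Fin n → ℝ}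
    {B : (Fin n → ℝ) → Prop} {m : ℕ} :
    Triple A q updateProg (fun s => Sampling A c D m s.row s.diag ∧ B (fun i => s.row 3 i / m))
      (fun s => ∃ p, B p ∧ s.row 0 = c ∧ s.row 1 = c + s.row 6 ∧
        RootsNear A q c (Real.log 2 / 2 ^ 10) p (s.row 6)) 0 := by
  refine Triple.then (R := fun s => s.row 0 = c ∧ B (s.row 3) ∧ ∀ i, A i = 0 → s.row 3 i = 0)
    (Triple.assignRow ?_) ?_
  · rintro s ⟨h, hB⟩
    refine ⟨by simpa using h.reg, ?_, fun i hi => ?_⟩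
    · simpa [Expr.eval, h.count] using hB
    · simp [Expr.eval, h.zero i hi]
  refine Triple.then (R := fun s => s.row 0 = c ∧ B (s.row 3) ∧ (∀ i, A i = 0 → s.row 3 i = 0) ∧
    RootsNear A q c (Real.log 2 / 2 ^ 0) (s.row 3) (s.row 6)) (Triple.assignRow ?_) ?_
  · rintro s ⟨h0, hB, hz⟩
    refine ⟨by simpa using h0, by simpa using hB, fun i hi => by simpa using hz i hi,
      fun i hi => ?_, fun i hi r hr h => ?_⟩
    · simp [startExpr, Expr.eval, hz i hi]
    · rw [pow_zero, div_one]
      simp only [Function.update_self]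
      exact eval_startExpr hq hq' (by simpa [h0] using hc i) hr (by simpa [h0] using h)
  have hloop := Triple.loop (A := A) (q := q) (m := .const 10) (P := .assignRow 6 improveExpr)
    (Q := fun k s => s.row 0 = c ∧ B (s.row 3) ∧ (∀ i, A i = 0 → s.row 3 i = 0) ∧
      RootsNear A q c (Real.log 2 / 2 ^ k) (s.row 3) (s.row 6)) (δ := 0)
    (fun k => Triple.assignRow ?_) (fun k s a h => h)
  · rw [mul_zero] at hloop
    refine hloop.then (Triple.assignRow ?_)
    rintro s ⟨h0, hB, hz, hR⟩
    refine ⟨s.row 3, hB, by simpa using h0, ?_, by simpa [Count.eval] using hR⟩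
    ext i
    simp [Expr.eval, h0]
  · rintro s ⟨h0, hB, hz, hR⟩
    refine ⟨by simpa using h0, by simpa using hB, fun i hi => by simpa using hz i hi,
      fun i hi => ?_, fun i hi r hr h => ?_⟩
    · simp [improveExpr, Expr.eval, hz i hi]
    · have h' : r * (s.row 0 i + r) ^ (2 / q - 1) = s.row 3 i := by simpa [h0] using h
      rw [pow_succ, ← div_div]
      simp only [Function.update_self]
      refine eval_improveExpr hq hq' (by simpa [h0] using hc i)
        (div_nonneg (Real.log_nonneg one_le_two) (by positivity)) hr h' (hR.2 i hi r hr ?_)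
      rw [← h', h0]

theorem logNear_of_relative {x y : ℝ} (h : (1 - 1 / 100) * y ≤ x) (h' : x ≤ (1 + 1 / 100) * y) :
    LogNear (1 / 90) x y := by
  have h1 := Real.add_one_le_exp (1 / 90 : ℝ)
  constructor <;> nlinarith

/-- The state between two rounds. -/
structure Progress (A : Matrix (Fin n) (Fin d) ℝ) (q : ℝ) (c w : Fin n → ℝ) (b : ℝ) (k : ℕ)
    (s : State n d) : Prop where
  reg : s.row 0 = c
  -- The 1/40 is stable under a round: 1/80 from halving, 1/90 from sampling and 1/1000 from root
  -- finding sum to less than 1/40.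
  approx : Approximates A q c w (b / 2 ^ k + 1 / 40) (s.row 1)
  -- Register `6` holds no weights before the first round. Weights lag one halving behind the forms,
  -- hence 2b/2^k; the constant covers 1/40 + 1/90 + 1/1000.
  near : 0 < k → ∀ i, (A i = 0 → s.row 6 i = 0) ∧
    (A i ≠ 0 → LogNear (2 * b / 2 ^ k + 3 / 80) (s.row 6 i) (w i))

theorem triple_round (hA : A.rank = d) (hq : 1 ≤ q) (hq' : q ≤ 2) (hc : ∀ i, 0 ≤ c i)
    (h : IsRegLewis A q c w) {b : ℝ} (hb : 0 ≤ b) {m : Count} (hm : 0 < m.eval n d) (k : ℕ) :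
    Triple A q (roundProg m) (Progress A q c w b k) (Progress A q c w b (k + 1))
      (ENNReal.ofReal (Real.exp (-((1 / 100) ^ 2 / 12)) ^ m.eval n d * (2 * n))) := by
  intro s hs
  have hη : Real.log 2 / 2 ^ 10 ≤ 1 / 1000 := by
    have := Real.log_two_lt_d9
    norm_num at this ⊢
    linarith
  have hη0 : 0 ≤ Real.log 2 / 2 ^ 10 := div_nonneg (Real.log_nonneg one_le_two) (by positivity)
  have hm' : (0 : ℝ) < m.eval n d := by exact_mod_cast hm
  have hb' : 0 ≤ b / 2 ^ k := by positivity
  have hsamples := triple_samples (A := A) (q := q) (c := c) hA (weightDiag_pos q (s.row 1))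
    (ε := 1 / 100) (by norm_num) (by norm_num) m
  have hupdate := triple_update (A := A) (D := weightDiag q (s.row 1)) (m := m.eval n d) hq hq' hc
    (B := fun p => ∀ i, A i ≠ 0 → LogNear (1 / 90) (p i) (quad A (weightDiag q (s.row 1)) i))
  have hall := triple_setup.then (Triple.seq hsamples fun t ht => hupdate t ⟨ht.1, fun i hi => ?_⟩)
  · have h1 := hall s ⟨hs.reg, rfl⟩
    rw [add_zero] at h1
    refine h1.mono (fun t => ?_) le_rfl
    rintro ⟨p, hp, h0, ht, hz, hR⟩
    have hstep := approximates_step hA hq hq' hc h (by linarith) (by norm_num) hη0 hs.approx hp hR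
    refine ⟨h0, ?_, fun _ i => ⟨hz i, fun hi => ?_⟩⟩
    · rw [ht]
      intro i hi
      refine (hstep i hi).mono ?_ (quad_nonneg hA (weightDiag_pos q _) i)
        (quad_nonneg hA (weightDiag_pos q _) i)
      rw [pow_succ (2 : ℝ) k, ← div_div]
      linarith
    · have h2 := (regLewis_near_of_approximates hA hq hq' hc h (by linarith) (by norm_num) hη0
        hs.approx hi (hp i hi) (hR i hi)).1
      have hwi : 0 < w i := scalar_root_pos (h.nonneg i) ((isRegLewis_iff.mp h).2.2 i hi).2
        (quad_pos hA (weightDiag_pos q _) hi)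
      refine h2.mono ?_ (h2.pos hwi).le hwi.le
      rw [pow_succ (2 : ℝ) k, mul_comm (2 ^ k : ℝ), mul_div_mul_left _ _ two_ne_zero]
      linarith
  · have h2 := ht.2 i hi
    refine logNear_of_relative ?_ ?_
    · rw [le_div_iff₀ hm']; linarith [h2.1]
    · rw [div_le_iff₀ hm']; linarith [h2.2]

theorem within_tenth {x y : ℝ} (h : LogNear (2 / 25) x y) (hy : 0 ≤ y) :
    9 / 10 * y ≤ x ∧ x ≤ 11 / 10 * y := by
  have h1 : Real.exp (2 / 25) ≤ 11 / 10 := by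
    have h2 := Real.add_one_le_exp (-(2 / 25) : ℝ)
    rw [Real.exp_neg] at h2
    have h3 := le_inv_of_le_inv₀ (by norm_num) h2
    refine h3.trans (by norm_num)
  have hx : 0 ≤ x := by
    have := hy.trans h.2
    exact (mul_nonneg_iff_of_pos_left (Real.exp_pos _)).mp this
  have h4 := mul_le_mul_of_nonneg_right h1 hx
  have h5 := mul_le_mul_of_nonneg_right h1 hy
  constructor
  · linarith [h.2]
  · linarith [h.1]

/-- The algorithm finds the Lewis weights up to a factor `1.1`, if the number of rounds is at least
logarithmic in `log n`. -/
theorem lewisProg_fails (hA : A.rank = d) (hn : 0 < n) (hq : 1 ≤ q) (hq' : q ≤ 2)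
    (hc : ∀ i, 0 ≤ c i) (h : IsRegLewis A q c w) {l m : Count} (hm : 0 < m.eval n d)
    (hl : 0 < l.eval n d) (hl' : 2 * Real.log (4 * n) / 2 ^ l.eval n d ≤ 1 / 25) :
    Fails ((lewisProg l m).final A c q) (fun s => ∀ i, 0 ≤ s.output i ∧
        (9 / 10 : ℝ) * w i ≤ s.output i ∧ s.output i ≤ (11 / 10 : ℝ) * w i)
      (l.eval n d *
        ENNReal.ofReal (Real.exp (-((1 / 100) ^ 2 / 12)) ^ m.eval n d * (2 * n))) := by
  have hn' : (1 : ℝ) ≤ n := by exact_mod_cast hn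
  have hb : 0 ≤ Real.log (4 * n) := Real.log_nonneg (by linarith)
  have hloop := Triple.loop (m := l) (triple_round hA hq hq' hc h hb hm)
    (fun k s a hs => ⟨hs.reg, hs.approx, hs.near⟩)
  have hend := hloop.seq (P' := .assignRow 0 (.reg 6)) (S := fun s => ∀ i, 0 ≤ s.output i ∧
    (9 / 10 : ℝ) * w i ≤ s.output i ∧ s.output i ≤ (11 / 10 : ℝ) * w i)
    (Triple.assignRow fun s hs i => ?_)
  · have hstart := Triple.then (Q := fun s : State n d => s.row 0 = c)
      (P := .assignRow 1 (.add (.reg 0) (.const 1))) (Triple.assignRow ?_) hend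
    · have h1 := hstart (State.init c) rfl
      rwa [add_zero] at h1
    · intro s hs
      refine ⟨by simpa using hs, ?_, fun h => absurd h (lt_irrefl 0)⟩
      have e : (fun i => Expr.eval q (fun l => s.row l i) (.add (.reg 0) (.const 1))) = c + 1 := by
        ext i
        simp [Expr.eval, hs]
      rw [e]
      simp only [Function.update_self]
      intro i hi
      refine (approximates_start hA hn hq hq' hc h i hi).mono (by rw [pow_zero, div_one]; linarith)
        (quad_nonneg hA (weightDiag_pos q _) i) (quad_nonneg hA (weightDiag_pos q _) i)
  · have h6 := hs.near hl i
    have e : (State.output { s with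
      row := Function.update s.row 0 (fun i => Expr.eval q (fun l => s.row l i) (.reg 6))
      ops := s.ops + n * (Expr.reg 6).size } i) = s.row 6 i := by
      simp [State.output, Expr.eval]
    rw [e]
    by_cases hi : A i = 0
    · simp [h6.1 hi, (isRegLewis_iff.mp h).2.1 i hi]
    · have hw := h.nonneg i
      have hwi : 0 < w i := scalar_root_pos hw ((isRegLewis_iff.mp h).2.2 i hi).2
        (quad_pos hA (weightDiag_pos q _) hi)
      have h7 := h6.2 hi
      -- The total error is at most 1/25 + 3/80 < 2/25, and e^(2/25) ≤ 25/23 < 11/10.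
      have h8 := h7.mono (b := 2 / 25) (by linarith) (h7.pos hwi).le hw
      exact ⟨(h7.pos hwi).le, within_tenth h8 hw⟩

end Correctness

/-! ### The number of rounds and samples -/

/-- The number of rounds: `log log n` up to constants. -/
def roundCount : Count := .add (.const 9) (.log (.add (.log .rows) (.const 1)))

/-- The number of samples in a round: `r log n` up to constants. -/
def sampleCount (r : ℕ) : Count := .mul (.const r) (.add (.log .rows) (.const 1))

section Parameters

variable {n d : ℕ}

theorem log_le_natLog_add_one (hn : 0 < n) : Real.log n ≤ Real.log 2 * (Nat.log 2 n + 1) := by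
  have h1 : (n : ℝ) ≤ 2 ^ (Nat.log 2 n + 1) := by
    exact_mod_cast (Nat.lt_pow_succ_log_self one_lt_two n).le
  have h2 := Real.log_le_log (by exact_mod_cast hn) h1
  rw [Real.log_pow] at h2
  push_cast at h2
  linarith

theorem natLog_le_two_mul_log (hn : 0 < n) : (Nat.log 2 n : ℝ) ≤ 2 * Real.log n := by
  have h1 : ((2 : ℝ) ^ Nat.log 2 n) ≤ n := by
    exact_mod_cast Nat.pow_log_le_self 2 hn.ne'
  have h2 := Real.log_le_log (by positivity) h1
  rw [Real.log_pow] at h2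
  have h3 := Real.log_two_gt_d9
  have h4 : (0 : ℝ) ≤ Nat.log 2 n := Nat.cast_nonneg _
  norm_num at h3
  nlinarith

theorem roundCount_eval : roundCount.eval n d = 9 + Nat.log 2 (Nat.log 2 n + 1) := rfl

theorem sampleCount_eval (r : ℕ) : (sampleCount r).eval n d = r * (Nat.log 2 n + 1) := rfl

/-- The offset 9 is one for rounding the logarithm down, plus 2^8, which beats the constant in 50
log(4n). -/
theorem roundCount_error (hn : 0 < n) :
    2 * Real.log (4 * n) / 2 ^ roundCount.eval n d ≤ 1 / 25 := by
  have h1 := log_le_natLog_add_one hn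
  have h2 := Real.log_two_lt_d9
  have h3 : Real.log (4 * n) = 2 * Real.log 2 + Real.log n := by
    rw [Real.log_mul (by norm_num) (by exact_mod_cast hn.ne'), show (4 : ℝ) = 2 ^ 2 by norm_num,
      Real.log_pow]
    norm_num
  have h4 : ((Nat.log 2 n : ℝ) + 1) * 256 ≤ 2 ^ roundCount.eval n d := by
    have h5 : Nat.log 2 n + 1 ≤ 2 ^ (Nat.log 2 (Nat.log 2 n + 1) + 1) :=
      (Nat.lt_pow_succ_log_self one_lt_two _).le
    have h6 : ((Nat.log 2 n : ℝ) + 1) ≤ 2 ^ (Nat.log 2 (Nat.log 2 n + 1) + 1) := by exact_mod_cast h5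
    rw [roundCount_eval, show 9 + Nat.log 2 (Nat.log 2 n + 1) =
      (Nat.log 2 (Nat.log 2 n + 1) + 1) + 8 by ring, pow_add]
    norm_num at h6 ⊢
    linarith
  have h7 : (0 : ℝ) ≤ Nat.log 2 n := Nat.cast_nonneg _
  rw [div_le_iff₀ (by positivity), h3]
  norm_num at h2
  nlinarith

theorem roundCount_le (n d : ℕ) : roundCount.eval n d ≤ Nat.log 2 n + 10 := by
  have := Nat.log_lt_self 2 (show Nat.log 2 n + 1 ≠ 0 by omega)
  rw [roundCount_eval]
  omega

theorem roundCount_le_log_log (hn : 0 < n) :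
    (roundCount.eval n d : ℝ) ≤ 11 * (1 + Real.log (1 + Real.log n)) := by
  have h0 : 0 ≤ Real.log n := Real.log_nonneg (by exact_mod_cast hn)
  have h1 := natLog_le_two_mul_log (n := Nat.log 2 n + 1) (Nat.succ_pos _)
  have h2 := natLog_le_two_mul_log hn
  have h3 : Real.log ((Nat.log 2 n + 1 : ℕ) : ℝ) ≤ Real.log 2 + Real.log (1 + Real.log n) := by
    rw [← Real.log_mul two_ne_zero (by linarith)]
    refine Real.log_le_log (by positivity) ?_
    push_cast
    linarith
  have h4 := Real.log_two_lt_d9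
  have h5 : 0 ≤ Real.log (1 + Real.log n) := Real.log_nonneg (by linarith)
  rw [roundCount_eval]
  push_cast at h1 h3 ⊢
  norm_num at h4
  linarith

/-- With ε = 1/100 a sample gains exp(-1/120000), so r (log₂ n + 1) samples gain n^(-C-20). The
spare n^(-20) absorbs the at most n^5 rounds and the factor 2n ≤ n². -/
theorem failure_bound {C : ℝ} {r : ℕ} (hr : 120000 * (C + 20) ≤ r) (hn : 2 ≤ n) :
    (roundCount.eval n d : ℝ≥0∞) * ENNReal.ofReal
      (Real.exp (-((1 / 100) ^ 2 / 12)) ^ (sampleCount r).eval n d * (2 * n)) ≤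
      ENNReal.ofReal ((n : ℝ) ^ (-C)) := by
  have hn0 : (0 : ℝ) < n := by exact_mod_cast (by omega : 0 < n)
  have hn2 : (2 : ℝ) ≤ n := by exact_mod_cast hn
  have hlog : 0 ≤ Real.log n := Real.log_nonneg (by linarith)
  rw [← ENNReal.ofReal_natCast, ← ENNReal.ofReal_mul (Nat.cast_nonneg _)]
  refine ENNReal.ofReal_le_ofReal ?_
  have h1 : (roundCount.eval n d : ℝ) ≤ n ^ 5 := by
    have h2 := roundCount_le n d
    have h3 : Nat.log 2 n ≤ n := Nat.log_le_self 2 n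
    have h4 : n + 10 ≤ n ^ 5 := by
      have : 2 ^ 4 ≤ n ^ 4 := Nat.pow_le_pow_left hn 4
      rw [pow_succ]
      nlinarith
    exact_mod_cast (by omega : roundCount.eval n d ≤ n ^ 5)
  have h2 : Real.exp (-((1 / 100) ^ 2 / 12)) ^ (sampleCount r).eval n d ≤
      (n : ℝ) ^ (-C) * ((n : ℝ) ^ 20)⁻¹ := by
    have e : (n : ℝ) ^ (-C) * ((n : ℝ) ^ 20)⁻¹ = Real.exp (-((C + 20) * Real.log n)) := by
      rw [← Real.rpow_natCast, ← Real.rpow_neg hn0.le, ← Real.rpow_add hn0,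
        Real.rpow_def_of_pos hn0]
      congr 1
      push_cast
      ring
    rw [e, ← Real.exp_nat_mul, sampleCount_eval]
    refine Real.exp_le_exp.mpr ?_
    have h3 := log_le_natLog_add_one (by omega : 0 < n)
    have h4 : Real.log n ≤ Nat.log 2 n + 1 := by
      have := Real.log_two_lt_d9
      have h7 : (0 : ℝ) ≤ Nat.log 2 n := Nat.cast_nonneg _
      norm_num at this
      nlinarith
    push_cast
    have h5 : (C + 20) * Real.log n ≤ r / 120000 * Real.log n :=
      mul_le_mul_of_nonneg_right (by linarith) hlog
    have h6 : (r : ℝ) / 120000 * Real.log n ≤ r / 120000 * (Nat.log 2 n + 1) :=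
      mul_le_mul_of_nonneg_left h4 (by positivity)
    linarith
  have h3 : 0 < (n : ℝ) ^ (-C) := Real.rpow_pos_of_pos hn0 _
  calc (roundCount.eval n d : ℝ) *
        (Real.exp (-((1 / 100) ^ 2 / 12)) ^ (sampleCount r).eval n d * (2 * n))
      ≤ n ^ 5 * ((n : ℝ) ^ (-C) * ((n : ℝ) ^ 20)⁻¹ * (n * n)) := by
        gcongr
    _ = (n : ℝ) ^ (-C) * ((n : ℝ) ^ 13)⁻¹ := by field_simp
    _ ≤ (n : ℝ) ^ (-C) := by
        refine mul_le_of_le_one_right h3.le (inv_le_one_of_one_le₀ ?_)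
        exact one_le_pow₀ (by linarith)

end Parameters

/-! ### The running time -/

section Time

variable {n d : ℕ}

theorem lewisProg_reweightCount (l m : Count) :
    (lewisProg l m).reweightCount n d = l.eval n d := by
  simp [lewisProg, roundProg, setupProg, updateProg, sampleProg, Prog.reweightCount]

theorem lewisProg_solveCount (l m : Count) :
    (lewisProg l m).solveCount n d = l.eval n d * m.eval n d := by
  simp [lewisProg, roundProg, setupProg, updateProg, sampleProg, Prog.solveCount]

theorem sampleProg_opCount_le {z : ℕ} (hd : d ≤ n) : sampleProg.opCount z n d ≤ 30 * (z + n) := by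
  simp [sampleProg, Prog.opCount, Expr.size]
  omega

theorem roundProg_opCount_le {z : ℕ} (hd : d ≤ n) (hn : 0 < n) (m : Count) :
    (roundProg m).opCount z n d ≤ m.size + 500 * (z + n) * (m.eval n d + 1) := by
  have h1 := sampleProg_opCount_le (z := z) hd
  have h2 : m.eval n d * (1 + sampleProg.opCount z n d) ≤ m.eval n d * (31 * (z + n)) :=
    Nat.mul_le_mul_left _ (by omega)
  simp only [roundProg, setupProg, updateProg, Prog.opCount, diagExpr, startExpr, improveExpr,
    exponentExpr, Expr.size, Count.size, Count.eval]
  nlinarith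

theorem lewisProg_opCount_le {z : ℕ} (hd : d ≤ n) (hn : 0 < n) (r : ℕ) :
    (lewisProg roundCount (sampleCount r)).opCount z n d ≤
      600 * (z + n) * ((sampleCount r).eval n d + 1) * (roundCount.eval n d + 1) := by
  have h1 := roundProg_opCount_le (z := z) hd hn (sampleCount r)
  have hs : (sampleCount r).size = 6 := rfl
  have hs' : roundCount.size = 7 := rfl
  rw [hs] at h1
  set M := (sampleCount r).eval n d
  set L := roundCount.eval n d
  have h2 : L * (1 + (roundProg (sampleCount r)).opCount z n d) ≤
      L * (507 * (z + n) * (M + 1)) := Nat.mul_le_mul_left _ (by nlinarith)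
  simp only [lewisProg, Prog.opCount, Expr.size, hs']
  change _ + (7 + L * _ + _) ≤ _
  nlinarith [Nat.zero_le (z * M), Nat.zero_le (n * M), Nat.zero_le (z * M * L),
    Nat.zero_le (n * M * L), Nat.zero_le (z * L), Nat.zero_le (n * L)]

end Time

theorem lewisProg_time_le {n d : ℕ} {A : Matrix (Fin n) (Fin d) ℝ} {q : ℝ} {c : Fin n → ℝ}
    (hA : A.rank = d) (hn : 0 < n) (r : ℕ) {s : State n d}
    (hs : s ∈ ((lewisProg roundCount (sampleCount r)).final A c q).support) {T : ℝ}
    (hT : (nnz A : ℝ) + n ≤ T) :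
    s.time T ≤ 13222 * (r + 1) * (1 + Real.log n) ^ 2 * T := by
  -- Full column rank gives d ≤ n, so operations on column registers are absorbed in nnz + n ≤ T.
  have hd : d ≤ n := hA ▸ A.rank_le_height
  have hsolves : s.solves = 0 + _ := Prog.solves_of_mem_support _ _ s hs
  have hops : s.ops = 0 + _ := Prog.ops_of_mem_support _ _ s hs
  rw [zero_add, lewisProg_solveCount] at hsolves
  rw [zero_add] at hops
  have hcount := lewisProg_opCount_le (z := nnz A) hd hn r
  rw [← hops] at hcount
  have hops' : (s.ops : ℝ) ≤ 600 * (nnz A + n) * ((sampleCount r).eval n d + 1) *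
      (roundCount.eval n d + 1) := by exact_mod_cast hcount
  have hlog : 0 ≤ Real.log n := Real.log_nonneg (by exact_mod_cast hn)
  have hℓ := natLog_le_two_mul_log hn
  have hM : ((sampleCount r).eval n d : ℝ) + 1 ≤ 2 * (r + 1) * (1 + Real.log n) := by
    have : (0 : ℝ) ≤ r := Nat.cast_nonneg _
    rw [sampleCount_eval]
    push_cast
    nlinarith
  have hL : (roundCount.eval n d : ℝ) + 1 ≤ 11 * (1 + Real.log n) := by
    have : (roundCount.eval n d : ℝ) ≤ Nat.log 2 n + 10 := by exact_mod_cast roundCount_le n d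
    linarith
  have hT0 : 0 ≤ T := le_trans (by positivity) hT
  rw [State.time, hsolves]
  push_cast
  set M := ((sampleCount r).eval n d : ℝ)
  set R := (roundCount.eval n d : ℝ)
  have hM0 : 0 ≤ M := Nat.cast_nonneg _
  have hR0 : 0 ≤ R := Nat.cast_nonneg _
  calc T * (R * M) + s.ops
      ≤ T * ((M + 1) * (R + 1)) + 600 * T * (M + 1) * (R + 1) := by
        refine add_le_add (mul_le_mul_of_nonneg_left (by nlinarith) hT0) (hops'.trans ?_)
        gcongr
    _ = 601 * T * ((M + 1) * (R + 1)) := by ring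
    _ ≤ 601 * T * (2 * (r + 1) * (1 + Real.log n) * (11 * (1 + Real.log n))) := by gcongr
    _ = 13222 * (r + 1) * (1 + Real.log n) ^ 2 * T := by ring

end RegLewis

theorem mainTheorem10 :
    -- the regularized Lewis weights are well defined
    (∀ (n d : ℕ) (A : Matrix (Fin n) (Fin d) ℝ) (q : ℝ) (c : Fin n → ℝ),
      A.rank = d → 1 ≤ q → q ≤ 2 → (∀ i, 0 ≤ c i) →
        ∃! w : Fin n → ℝ, RegLewis.IsRegLewis A q c w) ∧
    -- and can be approximated with high probability in nearly the time of one solve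
    ∃ k : ℕ, ∀ C : ℝ, 0 < C → ∃ (P : RegLewis.Prog) (K : ℝ),
      ∀ (n d : ℕ) (A : Matrix (Fin n) (Fin d) ℝ) (q : ℝ) (c w : Fin n → ℝ),
        0 < n → A.rank = d → 1 ≤ q → q ≤ 2 → (∀ i, 0 ≤ c i) →
        RegLewis.IsRegLewis A q c w →
          (1 - ENNReal.ofReal ((n : ℝ) ^ (-C)) ≤
            (P.final A c q).toOuterMeasure
              {s | ∀ i, 0 ≤ s.output i ∧
                (9 / 10 : ℝ) * w i ≤ s.output i ∧ s.output i ≤ (11 / 10 : ℝ) * w i}) ∧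
          ∀ s ∈ (P.final A c q).support,
            (s.reweights : ℝ) ≤ K * (1 + Real.log (1 + Real.log n)) ∧
            ∀ T : ℝ, (RegLewis.nnz A : ℝ) + n ≤ T →
              s.time T ≤ K * (1 + Real.log n) ^ k * T := by
  refine ⟨fun n d A q c hA hq hq' hc => RegLewis.existsUnique_isRegLewis hA hq hq' hc,
    2, fun C _ => ?_⟩
  obtain ⟨r, hr⟩ := exists_nat_ge (120000 * (C + 20))
  refine ⟨RegLewis.lewisProg RegLewis.roundCount (RegLewis.sampleCount r), 13222 * (r + 1),
    fun n d A q c w hn hA hq hq' hc hw => ⟨?_, fun s hs => ⟨?_, fun T hT =>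
      RegLewis.lewisProg_time_le hA hn r hs hT⟩⟩⟩
  · rcases (Nat.succ_le_of_lt hn).eq_or_lt with h1 | h1
    -- For n = 1 the permitted failure probability is 1 and nothing is claimed.
    · subst h1
      simp
    · have hr0 : 0 < r := by
        have : (0 : ℝ) < r := by linarith
        exact_mod_cast this
      refine RegLewis.one_sub_le_of_fails ((RegLewis.lewisProg_fails hA hn hq hq' hc hw
        ?_ ?_ (RegLewis.roundCount_error hn)).mono (fun _ h => h)
        (RegLewis.failure_bound hr h1))
      · rw [RegLewis.sampleCount_eval]
        positivity
      · rw [RegLewis.roundCount_eval]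
        positivity
  · have hrew : s.reweights = 0 + _ := RegLewis.Prog.reweights_of_mem_support _ _ s hs
    rw [zero_add, RegLewis.lewisProg_reweightCount] at hrew
    rw [hrew]
    have hlog : 0 ≤ Real.log n := Real.log_nonneg (by exact_mod_cast hn)
    have hlog' : 0 ≤ Real.log (1 + Real.log n) := Real.log_nonneg (by linarith)
    refine (RegLewis.roundCount_le_log_log hn).trans
      (mul_le_mul_of_nonneg_right ?_ (by linarith))
    have : (0 : ℝ) ≤ r := Nat.cast_nonneg _
    linarith
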